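/- Let $n\ge 1$ and let $\gamma_n(E)=(2\pi)^{-n/2}\int_E e^{-|x|^2/2}\,dx$ be the Gaussian probability measure on $\mathbb R^n$. A convex body is a compact convex subset of $\mathbb R^n$ with nonempty interior. For a convex body $K$ containing the origin in its interior, with support function $h_K(v)=\max_{x\in K}x\cdot v$, the Gaussian surface area measure $S_{\gamma_n,K}$ is the Borel measure on the unit sphere $S^{n-1}$ given by $$S_{\gamma_n,K}(\eta)=\frac{1}{(\sqrt{2\pi})^n}\int_{\nu_K^{-1}(\eta)}e^{-|x|^2/2}\,d\mathcal H^{n-1}(x)$$ for Borel sets $\eta\subset S^{n-1}$, where $\nu_K^{-1}(\eta)=\{x\in\partial K : x\cdot v=h_K(v)\text{ for some }v\in\eta\}$ and $\mathcal H^{n-1}$ is the $(n-1)$-dimensional Hausdorff measure. **Theorem.** Let $\mu$ be a finite even Borel measure on $S^{n-1}$ that is not concentrated in any closed hemisphere. Then for every $0<\alpha<\frac1n$ there is an origin-symmetric convex body $K$ in $\mathbb R^n$ such that $$\mu=\frac{S_{\gamma_n,K}}{\gamma_n(K)^{1-\alpha}}.$$ -/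

import Mathlib

open MeasureTheory

noncomputable section

namespace GaussianMinkowski

/-- Euclidean space `ℝⁿ`. -/
abbrev E (n : ℕ) : Type := EuclideanSpace ℝ (Fin n)

/-- The unit sphere `S^{n-1}` of `ℝⁿ`, with its Borel σ-algebra. -/
abbrev UnitSphere (n : ℕ) : Type := Metric.sphere (0 : E n) 1

/-- The Gaussian density `(√(2π))⁻ⁿ exp (-|x|² / 2)`. -/
def gaussianDensity (n : ℕ) (x : E n) : ENNReal :=
  ENNReal.ofReal (1 / (Real.sqrt (2 * Real.pi)) ^ n * Real.exp (-‖x‖ ^ 2 / 2))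

/-- The Gaussian probability measure `γₙ` on `ℝⁿ`. -/
def gaussianMeasure (n : ℕ) : Measure (E n) :=
  (volume : Measure (E n)).withDensity (gaussianDensity n)

/-- The support function `h_K(y) = max {x · y : x ∈ K}`. The maximum is attained, since the
carrier of a `ConvexBody` is compact and nonempty. -/
def supportFunction {n : ℕ} (K : ConvexBody (E n)) (y : E n) : ℝ :=
  sSup ((fun x : E n => inner ℝ x y) '' (K : Set (E n)))

/-- `v` is an outer unit normal of `K` at the boundary point `x`, that is, `x · v = h_K(v)`. -/
def IsOuterUnitNormal {n : ℕ} (K : ConvexBody (E n)) (x : E n) (v : UnitSphere n) : Prop :=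
  x ∈ frontier (K : Set (E n)) ∧ inner ℝ x (v : E n) = supportFunction K (v : E n)

/-- The inverse Gauss image `ν_K⁻¹(η)`: the boundary points of `K` that have at least one
outer unit normal in `η`. -/
def inverseGaussImage {n : ℕ} (K : ConvexBody (E n)) (η : Set (UnitSphere n)) : Set (E n) :=
  {x | ∃ v ∈ η, IsOuterUnitNormal K x v}

/-- The Gaussian surface area measure `S_{γₙ,K}`, given by its values
`(√(2π))⁻ⁿ ∫_{ν_K⁻¹(η)} exp (-|x|² / 2) dℋⁿ⁻¹(x)` on (Borel) sets `η ⊆ S^{n-1}`.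
Here `μHE[n - 1]` is the `(n-1)`-dimensional Hausdorff measure in the usual normalization, the
one that agrees with Lebesgue measure on `(n-1)`-dimensional subspaces. -/
def gaussianSurfaceArea {n : ℕ} (K : ConvexBody (E n)) (η : Set (UnitSphere n)) : ENNReal :=
  ∫⁻ x in inverseGaussImage K η, gaussianDensity n x ∂(μHE[n - 1] : Measure (E n))

/-- An origin-symmetric convex body in the sense of convex geometry. Mathlib's `ConvexBody` is a
nonempty compact convex set; here the interior has to be nonempty as well. -/
def IsOriginSymmetricBody {n : ℕ} (K : ConvexBody (E n)) : Prop :=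
  (interior (K : Set (E n))).Nonempty ∧ ∀ x ∈ K, -x ∈ K

/-- A measure on the sphere is even if it takes the same value on `η` and on `-η`, for every
Borel set `η`. -/
def IsEvenMeasure {n : ℕ} (μ : Measure (UnitSphere n)) : Prop :=
  ∀ η : Set (UnitSphere n), MeasurableSet η → μ ((fun v => -v) ⁻¹' η) = μ η

/-- The closed hemisphere centred at `u`. -/
def closedHemisphere {n : ℕ} (u : UnitSphere n) : Set (UnitSphere n) :=
  {v | 0 ≤ inner ℝ (u : E n) (v : E n)}

/-- `μ` is concentrated in the set `A`: the complement of `A` is `μ`-null. -/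
def IsConcentratedIn {n : ℕ} (μ : Measure (UnitSphere n)) (A : Set (UnitSphere n)) : Prop :=
  μ Aᶜ = 0

end GaussianMinkowski

end

noncomputable section

namespace GaussianMinkowski

open Set Filter Topology Metric Module
open scoped ENNReal NNReal Pointwise

/-! ### Cone measures and the volume of a cone over a flat piece -/

section Cone

variable {n : ℕ}

/-! The body is a maximizer of γ(K)^α/α − ∫ h_K dμ over symmetric compact convex sets
(`exists_maximizer`). Since μ is not concentrated in a closed hemisphere, ∫ h_K dμ controls the size
of K, so competitors of positive value lie in a fixed ball and Blaschke selection applies. Small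
balls have positive value because r^(nα) dominates r when nα < 1; hence the maximizer has positive
Gaussian measure, and therefore interior points.

The Euler–Lagrange equation comes from two one-sided inequalities instead of a two-sided variational
formula. Write S for the Gaussian surface area measure of K. Enlarging K to the Wulff shape of h_K +
t f, with f ≥ 0 even, and bounding the growth of γ from below by Fatou gives S ≤ γ(K)^(1-α) μ
(`lintegral_gaussianSurfaceMeasure_le_of_even`). Shrinking K to (1 - s)K gives γ(K)^(1-α) ∫ h_K dμ ≤
∫ h_K dS (`integral_supportFunction_le`). Because h_K > 0 on the sphere, the two together force
equality (`eq_of_le_of_lintegral_le`).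

Both variations are computed in polar coordinates adapted to the gauge g of K, in which the boundary
carries the cone measure: n times the volume of the cone over a set. The link with Hausdorff measure
is the density ‖∇g‖ (`IsConvexGauge.restrict_euclideanHausdorffMeasure`). On a hyperplane this is
"volume = base times height over n". Near a point of differentiability a convex function is strictly
differentiable, so a homogeneous map with bi-Lipschitz constant close to 1 flattens the level set
and carries cones to cones. The remaining points form a null set by Rademacher's theorem and
homogeneity. -/

/-- Positive homogeneity of degree one. -/
def PosHomogeneous (φ : E n → ℝ) : Prop := ∀ (r : ℝ) (x : E n), 0 < r → φ (r • x) = r * φ x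

/-- The part of the cone over `A` (a subset of the level set `φ = 1`) where `a < φ ≤ 1`. -/
def levelCone (φ : E n → ℝ) (a : ℝ) (A : Set (E n)) : Set (E n) :=
  {x | a < φ x ∧ φ x ≤ 1 ∧ (φ x)⁻¹ • x ∈ A}

/-- The cone measure of the level set `φ = 1`, normalized by the factor `n`. -/
def coneMeasure (φ : E n → ℝ) : Measure (E n) :=
  (n : ℝ≥0∞) • ((volume.restrict {x | 0 < φ x ∧ φ x ≤ 1}).map fun x => (φ x)⁻¹ • x)

lemma measurableSet_levelCone {φ : E n → ℝ} (hφ : Measurable φ) (a : ℝ) {A : Set (E n)}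
    (hA : MeasurableSet A) : MeasurableSet (levelCone φ a A) := by
  have h1 : MeasurableSet {x | a < φ x} := measurableSet_lt measurable_const hφ
  have h2 : MeasurableSet {x | φ x ≤ 1} := measurableSet_le hφ measurable_const
  have h3 : MeasurableSet {x | (φ x)⁻¹ • x ∈ A} := (hφ.inv.smul measurable_id) hA
  exact h1.inter (h2.inter h3)

lemma coneMeasure_apply {φ : E n → ℝ} (hφ : Measurable φ) {A : Set (E n)}
    (hA : MeasurableSet A) : coneMeasure φ A = n * volume (levelCone φ 0 A) := by
  have hm : Measurable fun x : E n => (φ x)⁻¹ • x := hφ.inv.smul measurable_id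
  rw [coneMeasure, Measure.smul_apply, Measure.map_apply hm hA,
    Measure.restrict_apply (hm hA), smul_eq_mul]
  congr 2
  ext x
  simp only [levelCone, mem_inter_iff, mem_preimage, mem_ofPred_eq]
  tauto

/-- Below height `a` the cone is its own dilate by `a`. This recovers the whole cone from the part
near its base, the only part where local estimates are available. -/
lemma volume_levelCone_eq_add {φ : E n → ℝ} (hφ : Measurable φ) (hom : PosHomogeneous φ)
    {A : Set (E n)} (hA : MeasurableSet A) {a : ℝ} (ha : 0 < a) (ha1 : a < 1) :
    volume (levelCone φ 0 A) =
      volume (levelCone φ a A) + ENNReal.ofReal (a ^ n) * volume (levelCone φ 0 A) := by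
  have hsplit : levelCone φ 0 A = levelCone φ a A ∪ a • levelCone φ 0 A := by
    ext x
    rw [mem_union, mem_smul_set_iff_inv_smul_mem₀ ha.ne']
    simp only [levelCone, mem_ofPred_eq, hom _ _ (inv_pos.2 ha), smul_smul, mul_inv, inv_inv]
    have e : a * (φ x)⁻¹ * a⁻¹ = (φ x)⁻¹ := by field_simp
    rw [e, mul_pos_iff_of_pos_left (inv_pos.2 ha), inv_mul_le_one₀ ha]
    constructor
    · rintro ⟨h1, h2, h3⟩
      rcases lt_or_ge a (φ x) with h | h
      · exact Or.inl ⟨h, h2, h3⟩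
      · exact Or.inr ⟨h1, h, h3⟩
    · rintro (⟨h1, h2, h3⟩ | ⟨h1, h2, h3⟩)
      · exact ⟨ha.trans h1, h2, h3⟩
      · exact ⟨h1, h2.trans ha1.le, h3⟩
  have hdisj : Disjoint (levelCone φ a A) (a • levelCone φ 0 A) := by
    rw [disjoint_left]
    intro x hx hx'
    rw [mem_smul_set_iff_inv_smul_mem₀ ha.ne'] at hx'
    have := hx'.2.1
    rw [hom _ _ (inv_pos.2 ha), inv_mul_le_one₀ ha] at this
    exact absurd hx.1 (not_lt.2 this)
  conv_lhs => rw [hsplit]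
  rw [measure_union hdisj ((measurableSet_levelCone hφ 0 hA).const_smul₀ a),
    Measure.addHaar_smul_of_nonneg _ ha.le, finrank_euclideanSpace_fin]

lemma levelCone_subset_closedBall {φ : E n → ℝ} {A : Set (E n)} {R : ℝ}
    (hA : A ⊆ closedBall 0 R) : levelCone φ 0 A ⊆ closedBall 0 R := by
  rintro x ⟨h0, h1, hx⟩
  have h := hA hx
  rw [mem_closedBall_zero_iff, norm_smul, norm_inv, Real.norm_of_nonneg h0.le,
    inv_mul_le_iff₀ h0] at h
  rw [mem_closedBall_zero_iff]
  have hR : 0 ≤ R := by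
    by_contra hR
    have := mul_neg_of_pos_of_neg h0 (not_le.1 hR)
    linarith [norm_nonneg x]
  nlinarith

lemma volume_levelCone_lt_top {φ : E n → ℝ} {A : Set (E n)} (hA : Bornology.IsBounded A) :
    volume (levelCone φ 0 A) < ∞ := by
  obtain ⟨R, hR⟩ := hA.subset_closedBall 0
  exact (measure_mono (levelCone_subset_closedBall hR)).trans_lt measure_closedBall_lt_top

lemma posHomogeneous_inner (p : E n) : PosHomogeneous fun x => inner ℝ p x := by
  intro r x _
  simp [inner_smul_right]

lemma levelCone_inner_inter_slice {p : E n} (hp : p ≠ 0) (A : Set (E n))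
    (hA : A ⊆ {x | inner ℝ p x = 1}) (t : ℝ) :
    levelCone (fun x => inner ℝ p x) 0 A ∩
      AffineSubspace.mk' (t • ((‖p‖ ^ 2)⁻¹ • p) +ᵥ (0 : E n)) (ℝ ∙ ((‖p‖ ^ 2)⁻¹ • p))ᗮ =
      if t ∈ Ioc (0 : ℝ) 1 then t • A else ∅ := by
  have hp2 : (‖p‖ ^ 2) ≠ 0 := by simpa using hp
  have hmem : ∀ x : E n, x ∈ AffineSubspace.mk' (t • ((‖p‖ ^ 2)⁻¹ • p) +ᵥ (0 : E n))
      (ℝ ∙ ((‖p‖ ^ 2)⁻¹ • p))ᗮ ↔ inner ℝ p x = t := by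
    intro x
    rw [AffineSubspace.mem_mk', Submodule.mem_orthogonal_singleton_iff_inner_right]
    simp only [vadd_eq_add, add_zero, vsub_eq_sub, inner_smul_left, inner_sub_right,
      inner_smul_right, real_inner_self_eq_norm_sq]
    rw [RCLike.conj_to_real, inv_mul_cancel₀ hp2, mul_one, mul_comm t, ← mul_sub, mul_eq_zero,
      or_iff_right (inv_ne_zero hp2), sub_eq_zero]
  ext x
  rw [mem_inter_iff, SetLike.mem_coe, hmem]
  split_ifs with ht
  · rw [mem_smul_set_iff_inv_smul_mem₀ ht.1.ne']
    simp only [levelCone, mem_ofPred_eq]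
    constructor
    · rintro ⟨⟨-, -, h⟩, rfl⟩
      exact h
    · intro h
      have h1 := hA h
      simp only [mem_ofPred_eq, inner_smul_right] at h1
      have h2 : inner ℝ p x = t := by
        have := ht.1.ne'
        field_simp at h1
        exact h1
      rw [h2]
      exact ⟨⟨ht.1, ht.2, h⟩, rfl⟩
  · simp only [levelCone, mem_ofPred_eq, mem_empty_iff_false, iff_false]
    rintro ⟨⟨h1, h2, -⟩, rfl⟩
    exact ht ⟨h1, h2⟩

lemma lintegral_Ioc_pow (hn : 1 ≤ n) :
    ∫⁻ t in Ioc (0 : ℝ) 1, ENNReal.ofReal (t ^ (n - 1)) = (n : ℝ≥0∞)⁻¹ := by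
  rw [← ofReal_integral_eq_lintegral_ofReal (intervalIntegral.intervalIntegrable_pow _).1,
    ← intervalIntegral.integral_of_le zero_le_one]
  · have h0 : (0 : ℝ) < n := by exact_mod_cast hn
    simp only [integral_pow, Nat.sub_add_cancel hn, Nat.cast_sub hn, Nat.cast_one, sub_add_cancel,
      one_pow, zero_pow (by omega : n ≠ 0), sub_zero, one_div]
    rw [ENNReal.ofReal_inv_of_pos h0, ENNReal.ofReal_natCast]
  · filter_upwards [ae_restrict_mem measurableSet_Ioc] with y hy
    exact pow_nonneg hy.1.le _

/-- The volume of a cone over a piece of a hyperplane. -/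
lemma euclideanHausdorffMeasure_eq_coneMeasure_inner (hn : 1 ≤ n) {p : E n} (hp : p ≠ 0)
    {A : Set (E n)} (hAm : MeasurableSet A) (hA : A ⊆ {x | inner ℝ p x = 1}) :
    (μHE[n - 1] : Measure (E n)) A = ‖p‖ₑ * coneMeasure (fun x => inner ℝ p x) A := by
  have hmeas : Measurable fun x : E n => inner ℝ p x := by fun_prop
  have hp2 : (‖p‖ ^ 2) ≠ 0 := by simpa using hp
  -- With `v = p / ‖p‖²` the slicing parameter `t` is the height `inner ℝ p x`, so the slices are `t
  -- • A`; the factor `‖v‖ = 1 / ‖p‖` of the slicing formula accounts for `‖p‖` in the result.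
  have key := EuclideanGeometry.euclideanHausdorffMeasure_eq_lintegral (0 : E n)
    (v := (‖p‖ ^ 2)⁻¹ • p) (by simp [hp]) (measurableSet_levelCone hmeas 0 hAm)
  rw [finrank_euclideanSpace_fin, EuclideanSpace.euclideanHausdorffMeasure_eq_volume] at key
  simp_rw [levelCone_inner_inter_slice hp A hA] at key
  have hint : (∫⁻ t : ℝ, (μHE[n - 1] : Measure (E n)) (if t ∈ Ioc (0 : ℝ) 1 then t • A else ∅)) =
      (n : ℝ≥0∞)⁻¹ * (μHE[n - 1] : Measure (E n)) A := by
    rw [← lintegral_Ioc_pow hn, ← lintegral_mul_const _ (by fun_prop),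
      ← lintegral_indicator measurableSet_Ioc]
    refine lintegral_congr fun t => ?_
    by_cases ht : t ∈ Ioc (0 : ℝ) 1
    · rw [if_pos ht, indicator_of_mem ht, Measure.euclideanHausdorffMeasure_smul₀ _ ht.1.ne',
        ENNReal.smul_def, smul_eq_mul, ENNReal.ofReal_pow ht.1.le, ENNReal.coe_pow,
        ← Real.enorm_of_nonneg ht.1.le]
      rfl
    · rw [if_neg ht, indicator_of_notMem ht, measure_empty]
  rw [hint] at key
  rw [coneMeasure_apply hmeas hAm, key]
  have hn0 : (n : ℝ≥0∞) ≠ 0 := by exact_mod_cast (by omega : n ≠ 0)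
  have e1 : ‖p‖ₑ * ‖(‖p‖ ^ 2)⁻¹ • p‖ₑ = 1 := by
    rw [← enorm_norm p, ← enorm_norm (_ • p), ← enorm_mul, norm_smul]
    have : ‖p‖ * (‖(‖p‖ ^ 2)⁻¹‖ * ‖p‖) = 1 := by
      simp
      field_simp
    rw [this]; simp
  calc (μHE[n - 1] : Measure (E n)) A
      = (‖p‖ₑ * ‖(‖p‖ ^ 2)⁻¹ • p‖ₑ) * ((n * (n : ℝ≥0∞)⁻¹) * (μHE[n - 1] : Measure (E n)) A) := by
        rw [e1, ENNReal.mul_inv_cancel hn0 (by simp)]; simp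
    _ = _ := by ring

end Cone

/-! ### Convex gauges and the flattening of their level sets -/

section Gauge

variable {n : ℕ}

/-- Functions that behave like the gauge of a convex body with the origin in its interior. -/
structure IsConvexGauge (g : E n → ℝ) : Prop where
  smul : ∀ (r : ℝ) (x : E n), 0 ≤ r → g (r • x) = r * g x
  add_le : ∀ x y : E n, g (x + y) ≤ g x + g y
  pos : ∀ x : E n, x ≠ 0 → 0 < g x
  lip : ∃ L : ℝ≥0, LipschitzWith L g

namespace IsConvexGauge

variable {g : E n → ℝ}

lemma posHomogeneous (hg : IsConvexGauge g) : PosHomogeneous g := fun r x hr => hg.smul r x hr.le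

lemma continuous (hg : IsConvexGauge g) : Continuous g := hg.lip.choose_spec.continuous

lemma map_zero (hg : IsConvexGauge g) : g 0 = 0 := by
  simpa using hg.smul 0 0 le_rfl

lemma convexOn (hg : IsConvexGauge g) : ConvexOn ℝ univ g :=
  ⟨convex_univ, fun x _ y _ a b ha hb _ => by
    simpa [hg.smul _ _ ha, hg.smul _ _ hb] using hg.add_le (a • x) (b • y)⟩

lemma ne_zero_of_eq_one (hg : IsConvexGauge g) {x : E n} (h : g x = 1) : x ≠ 0 := by
  rintro rfl
  rw [hg.map_zero] at h
  exact zero_ne_one h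

/-- Subadditivity bounds every right difference quotient in direction `y` by `g y`. -/
lemma fderiv_le (hg : IsConvexGauge g) {x : E n} (hd : DifferentiableAt ℝ g x) (y : E n) :
    fderiv ℝ g x y ≤ g y := by
  have h := hd.hasFDerivAt.hasLineDerivAt y
  have h' := HasDerivAt.tendsto_slope_zero_right (f := fun t : ℝ => g (x + t • y)) h
  refine le_of_tendsto h' ?_
  filter_upwards [self_mem_nhdsWithin] with t ht
  have ht : 0 < t := ht
  have := hg.add_le x (t • y)
  rw [hg.smul _ _ ht.le] at this
  simp only [zero_add, zero_smul, add_zero, smul_eq_mul]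
  rw [inv_mul_le_iff₀ ht]
  linarith

/-- Euler's identity. The lower bound comes from direction `-x`, along which `g` is exactly linear
for small times. -/
lemma fderiv_self (hg : IsConvexGauge g) {x : E n} (hd : DifferentiableAt ℝ g x) :
    fderiv ℝ g x x = g x := by
  refine le_antisymm (hg.fderiv_le hd x) ?_
  have h := hd.hasFDerivAt.hasLineDerivAt (-x)
  have h' := HasDerivAt.tendsto_slope_zero_right (f := fun t : ℝ => g (x + t • (-x))) h
  rw [map_neg] at h'
  rw [← neg_le_neg_iff]
  refine le_of_tendsto h' ?_
  filter_upwards [Ioo_mem_nhdsGT (zero_lt_one' ℝ)] with t ht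
  have e : x + t • (-x) = (1 - t) • x := by rw [smul_neg, sub_smul, one_smul, sub_eq_add_neg]
  simp only [zero_add, zero_smul, add_zero, smul_eq_mul]
  rw [e, hg.smul _ _ (by linarith [ht.2]), inv_mul_le_iff₀ ht.1]
  linarith

lemma differentiableAt_smul (hg : IsConvexGauge g) {x : E n} {r : ℝ} (hr : 0 < r)
    (hd : DifferentiableAt ℝ g x) : DifferentiableAt ℝ g (r • x) := by
  have e : g = fun y => r * g (r⁻¹ • y) := by
    funext y
    rw [hg.smul _ _ (inv_pos.2 hr).le, mul_inv_cancel_left₀ hr.ne']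
  rw [e]
  refine DifferentiableAt.const_mul ?_ r
  refine DifferentiableAt.comp (r • x) (g := g) ?_ (by fun_prop)
  rwa [inv_smul_smul₀ hr.ne']

/-- A convex function is strictly differentiable wherever it is differentiable. -/
lemma exists_lipschitzOnWith_sub_fderiv (hg : IsConvexGauge g) {x₀ : E n}
    (hd : DifferentiableAt ℝ g x₀) {ε : ℝ} (hε : 0 < ε) :
    ∃ r > 0, LipschitzOnWith ε.toNNReal (fun y => g y - fderiv ℝ g x₀ y) (ball x₀ r) := by
  -- A convex function bounded by `M` on a ball of radius `ρ` is `2M / (ρ/2)`-Lipschitz on the half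
  -- ball. Minus its first-order expansion, `g` has `M = ε/4 * ρ`, which yields the constant `ε`.
  have h := hd.hasFDerivAt.isLittleO.def (show 0 < ε / 4 by positivity)
  obtain ⟨ρ, hρ, hb⟩ := Metric.eventually_nhds_iff_ball.1 h
  have hconv : ConvexOn ℝ (ball x₀ ρ)
      fun y => (g y - fderiv ℝ g x₀ y) + (-(g x₀ - fderiv ℝ g x₀ x₀)) := by
    have h1 : ConvexOn ℝ univ fun y => (g y - fderiv ℝ g x₀ y) := by
      refine hg.convexOn.sub ?_
      exact (fderiv ℝ g x₀).toLinearMap.concaveOn convex_univ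
    exact (h1.subset (subset_univ _) (convex_ball _ _)).add_const _
  have hM : ∀ a, dist a x₀ < ρ →
      |(g a - fderiv ℝ g x₀ a) + (-(g x₀ - fderiv ℝ g x₀ x₀))| ≤ ε / 4 * ρ := by
    intro a ha
    have h2 := hb a ha
    rw [Real.norm_eq_abs, map_sub] at h2
    rw [dist_eq_norm] at ha
    calc _ = |g a - g x₀ - (fderiv ℝ g x₀ a - fderiv ℝ g x₀ x₀)| := by congr 1; ring
      _ ≤ ε / 4 * ‖a - x₀‖ := h2
      _ ≤ ε / 4 * ρ := by gcongr
  have hl := hconv.lipschitzOnWith_of_abs_le (half_pos hρ) hM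
  refine ⟨ρ / 2, half_pos hρ, ?_⟩
  rw [show 2 * (ε / 4 * ρ) / (ρ / 2) = ε by field_simp; norm_num, show ρ - ρ / 2 = ρ / 2 by ring] at hl
  intro x hx y hy
  simpa using hl hx hy

end IsConvexGauge

lemma _root_.LipschitzOnWith.euclideanHausdorffMeasure_image_le {X Y : Type*}
    [EMetricSpace X] [MeasurableSpace X] [BorelSpace X]
    [EMetricSpace Y] [MeasurableSpace Y] [BorelSpace Y] {K : ℝ≥0} {f : X → Y} {s : Set X}
    (h : LipschitzOnWith K f s) (d : ℕ) :
    (μHE[d] : Measure Y) (f '' s) ≤ (K : ℝ≥0∞) ^ d * (μHE[d] : Measure X) s := by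
  simp only [Measure.euclideanHausdorffMeasure_def, Measure.smul_apply, ENNReal.smul_def,
    smul_eq_mul]
  have := h.hausdorffMeasure_image_le (d := d) (Nat.cast_nonneg _)
  rw [ENNReal.rpow_natCast] at this
  calc _ ≤ _ := mul_le_mul_right this _
    _ = _ := by ring

lemma euclideanHausdorffMeasure_le_image {K : ℝ≥0} {f : E n → E n} {s : Set (E n)}
    (h : ∀ x ∈ s, ∀ y ∈ s, dist x y ≤ K * dist (f x) (f y)) (d : ℕ) :
    (μHE[d] : Measure (E n)) s ≤ (K : ℝ≥0∞) ^ d * (μHE[d] : Measure (E n)) (f '' s) := by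
  have hinj : InjOn f s := fun x hx y hy hxy => by
    have := h x hx y hy
    rw [hxy, dist_self, mul_zero] at this
    exact dist_le_zero.1 this
  rcases s.eq_empty_or_nonempty with rfl | hne
  · simp
  have hl : LipschitzOnWith K (Function.invFunOn f s) (f '' s) := by
    refine LipschitzOnWith.of_dist_le_mul ?_
    rintro _ ⟨x, hx, rfl⟩ _ ⟨y, hy, rfl⟩
    rw [hinj.leftInvOn_invFunOn hx, hinj.leftInvOn_invFunOn hy]
    exact h x hx y hy
  have := hl.euclideanHausdorffMeasure_image_le d
  rwa [hinj.leftInvOn_invFunOn.image_image] at this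

/-- The `1`-homogeneous map that flattens the level sets of `g` to hyperplanes orthogonal to `p`. -/
def straighten (g : E n → ℝ) (p : E n) (y : E n) : E n :=
  y + (g y - inner ℝ p y) • ((‖p‖ ^ 2)⁻¹ • p)

lemma inner_straighten (g : E n → ℝ) {p : E n} (hp : p ≠ 0) (y : E n) :
    inner ℝ p (straighten g p y) = g y := by
  have hp2 : (‖p‖ ^ 2) ≠ 0 := by simpa using hp
  simp only [straighten, inner_add_right, inner_smul_right, real_inner_self_eq_norm_sq]
  rw [inv_mul_cancel₀ hp2]
  ring

lemma straighten_smul {g : E n → ℝ} (hg : PosHomogeneous g) (p : E n) {r : ℝ} (hr : 0 < r)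
    (y : E n) : straighten g p (r • y) = r • straighten g p y := by
  simp only [straighten, hg r y hr, inner_smul_right, smul_add, ← mul_sub, mul_smul]

/-- Being homogeneous and carrying `g` to `inner ℝ p`, the flattening commutes with the radial
projections onto the two level sets. -/
lemma straighten_image_levelCone {g : E n → ℝ} (hg : PosHomogeneous g) {p : E n} (hp : p ≠ 0)
    {a : ℝ} (ha : 0 ≤ a) (A : Set (E n)) :
    straighten g p '' levelCone g a A =
      levelCone (fun x => inner ℝ p x) a (straighten g p '' A) := by
  ext z
  simp only [levelCone, mem_image, mem_ofPred_eq]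
  constructor
  · rintro ⟨y, ⟨h1, h2, h3⟩, rfl⟩
    rw [inner_straighten g hp]
    exact ⟨h1, h2, _, h3, straighten_smul hg p (inv_pos.2 (ha.trans_lt h1)) y⟩
  · rintro ⟨h1, h2, x, hx, hxz⟩
    have ht : 0 < inner ℝ p z := ha.trans_lt h1
    have hz : straighten g p ((inner ℝ p z) • x) = z := by
      rw [straighten_smul hg p ht, hxz, smul_inv_smul₀ ht.ne']
    have hgz : g ((inner ℝ p z : ℝ) • x) = inner ℝ p z := by
      rw [← inner_straighten g hp, hz]
    refine ⟨_, ⟨?_, ?_, ?_⟩, hz⟩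
    · rwa [hgz]
    · rwa [hgz]
    · rwa [hgz, inv_smul_smul₀ ht.ne']

/-- The flattening is the identity plus a map of Lipschitz constant `δ = 1 - k⁻¹`, so it distorts
distances by factors between `1 - δ = k⁻¹` and `1 + δ = 2 - k⁻¹ ≤ k`. -/
lemma dist_straighten_bounds {g : E n → ℝ} {p : E n} (hp : p ≠ 0) {k : ℝ} (hk : 1 < k)
    {s : Set (E n)}
    (hl : LipschitzOnWith ((1 - k⁻¹) * ‖p‖).toNNReal (fun y => g y - inner ℝ p y) s)
    {x y : E n} (hx : x ∈ s) (hy : y ∈ s) :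
    dist (straighten g p x) (straighten g p y) ≤ k * dist x y ∧
      dist x y ≤ k * dist (straighten g p x) (straighten g p y) := by
  have hk0 : 0 < k := by linarith
  have hδ : 0 ≤ 1 - k⁻¹ := sub_nonneg.2 (inv_le_one_of_one_le₀ hk.le)
  have hp0 : 0 < ‖p‖ := norm_pos_iff.2 hp
  have h1 := hl.dist_le_mul x hx y hy
  rw [Real.coe_toNNReal _ (by positivity), Real.dist_eq] at h1
  set c : ℝ := (g x - inner ℝ p x) - (g y - inner ℝ p y) with hc
  have hdiff : straighten g p x - straighten g p y = (x - y) + c • ((‖p‖ ^ 2)⁻¹ • p) := by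
    simp only [straighten, hc, sub_smul]
    abel
  have hn : ‖c • ((‖p‖ ^ 2)⁻¹ • p)‖ ≤ (1 - k⁻¹) * dist x y := by
    rw [norm_smul, norm_smul, Real.norm_eq_abs, norm_inv, norm_pow, norm_norm]
    calc |c| * ((‖p‖ ^ 2)⁻¹ * ‖p‖) ≤ ((1 - k⁻¹) * ‖p‖ * dist x y) * ((‖p‖ ^ 2)⁻¹ * ‖p‖) := by
          gcongr
      _ = _ := by field_simp
  have hd0 : 0 ≤ dist x y := dist_nonneg
  rw [dist_eq_norm (straighten g p x), hdiff]
  have hkk : (k + k⁻¹ - 2) ≥ 0 := by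
    have : k + k⁻¹ - 2 = (k - 1) ^ 2 / k := by field_simp; ring
    rw [this]; positivity
  constructor
  · calc _ ≤ ‖x - y‖ + ‖c • ((‖p‖ ^ 2)⁻¹ • p)‖ := norm_add_le _ _
      _ ≤ dist x y + (1 - k⁻¹) * dist x y := by rw [← dist_eq_norm]; gcongr
      _ ≤ k * dist x y := by nlinarith
  · have : ‖x - y‖ - ‖c • ((‖p‖ ^ 2)⁻¹ • p)‖ ≤ ‖(x - y) + c • ((‖p‖ ^ 2)⁻¹ • p)‖ := by
      have := norm_sub_le ((x - y) + c • ((‖p‖ ^ 2)⁻¹ • p)) (c • ((‖p‖ ^ 2)⁻¹ • p))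
      rw [add_sub_cancel_right] at this
      linarith
    rw [← dist_eq_norm] at this
    have h3 : k⁻¹ * dist x y ≤ ‖(x - y) + c • ((‖p‖ ^ 2)⁻¹ • p)‖ := by linarith
    rwa [inv_mul_le_iff₀ hk0] at h3

end Gauge

/-! ### Hausdorff measure on a level set in terms of the cone measure -/

section SurfaceArea

variable {n : ℕ} {g : E n → ℝ}

lemma inner_gradient (g : E n → ℝ) (x y : E n) : inner ℝ (gradient g x) y = fderiv ℝ g x y := by
  rw [gradient, InnerProductSpace.toDual_symm_apply]

lemma measurable_gradient (g : E n → ℝ) : Measurable (gradient g) :=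
  (InnerProductSpace.toDual ℝ (E n)).symm.continuous.measurable.comp (measurable_fderiv ℝ g)

/-- Near a point of differentiability the gradient is almost constant in norm. -/
lemma norm_gradient_compare {x₀ : E n} {k r : ℝ} (hk : 1 < k)
    (hl : LipschitzOnWith ((1 - k⁻¹) * ‖gradient g x₀‖).toNNReal
      (fun y => g y - inner ℝ (gradient g x₀) y) (ball x₀ r))
    {x : E n} (hx : x ∈ ball x₀ r) (hd : DifferentiableAt ℝ g x) :
    ‖gradient g x‖ ≤ k * ‖gradient g x₀‖ ∧ ‖gradient g x₀‖ ≤ k * ‖gradient g x‖ := by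
  have hk0 : 0 < k := by linarith
  have hδ : 0 ≤ 1 - k⁻¹ := sub_nonneg.2 (inv_le_one_of_one_le₀ hk.le)
  have h := norm_fderiv_le_of_lipschitzOn ℝ (isOpen_ball.mem_nhds hx) hl
  simp_rw [inner_gradient] at h
  rw [fderiv_fun_sub hd (by fun_prop), ContinuousLinearMap.fderiv,
    Real.coe_toNNReal _ (by positivity)] at h
  have hgrad : ‖gradient g x - gradient g x₀‖ = ‖fderiv ℝ g x - fderiv ℝ g x₀‖ := by
    rw [gradient, gradient, ← map_sub, LinearIsometryEquiv.norm_map]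
  rw [← hgrad] at h
  have hkk : (k + k⁻¹ - 2) ≥ 0 := by
    have : k + k⁻¹ - 2 = (k - 1) ^ 2 / k := by field_simp; ring
    rw [this]; positivity
  have h1 := norm_sub_norm_le (gradient g x) (gradient g x₀)
  have h2 := norm_sub_norm_le (gradient g x₀) (gradient g x)
  rw [norm_sub_rev] at h2
  have hp := norm_nonneg (gradient g x₀)
  constructor
  · nlinarith
  · rw [← inv_mul_le_iff₀ hk0]
    nlinarith

namespace IsConvexGauge

lemma gradient_ne_zero (hg : IsConvexGauge g) {x : E n} (h1 : g x = 1)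
    (hd : DifferentiableAt ℝ g x) : gradient g x ≠ 0 := by
  intro h
  have := hg.fderiv_self hd
  rw [← inner_gradient, h, inner_zero_left, h1] at this
  exact zero_ne_one this

/-- Near a point of differentiability, the Hausdorff measure of the level set is comparable to
the cone measure times the norm of the gradient. -/
lemma exists_ball_compare (hg : IsConvexGauge g) (hn : 1 ≤ n) {x₀ : E n} (h1 : g x₀ = 1)
    (hd : DifferentiableAt ℝ g x₀) {k : ℝ≥0} (hk : 1 < k) :
    ∃ r > 0, (∀ x ∈ ball x₀ r, DifferentiableAt ℝ g x →
        ‖gradient g x‖ₑ ≤ k * ‖gradient g x₀‖ₑ ∧ ‖gradient g x₀‖ₑ ≤ k * ‖gradient g x‖ₑ) ∧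
      ∀ A ⊆ ball x₀ r, A ⊆ {x | g x = 1} → MeasurableSet A →
        (μHE[n - 1] : Measure (E n)) A ≤
          (k : ℝ≥0∞) ^ (2 * n) * (‖gradient g x₀‖ₑ * coneMeasure g A) ∧
        ‖gradient g x₀‖ₑ * coneMeasure g A ≤
          (k : ℝ≥0∞) ^ (2 * n) * (μHE[n - 1] : Measure (E n)) A := by
  set p := gradient g x₀ with hpdef
  have hp : p ≠ 0 := hg.gradient_ne_zero h1 hd
  have hk' : (1 : ℝ) < k := by exact_mod_cast hk
  have hδ : 0 < 1 - (k : ℝ)⁻¹ := sub_pos.2 (inv_lt_one_of_one_lt₀ hk')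
  obtain ⟨r₀, hr₀, hl⟩ := hg.exists_lipschitzOnWith_sub_fderiv hd
    (ε := (1 - (k : ℝ)⁻¹) * ‖p‖) (mul_pos hδ (norm_pos_iff.2 hp))
  simp_rw [← inner_gradient, ← hpdef] at hl
  refine ⟨r₀ / 2, half_pos hr₀, ?_, ?_⟩
  · intro x hx hdx
    have := norm_gradient_compare hk' hl (ball_subset_ball (half_le_self hr₀.le) hx) hdx
    simp only [enorm_eq_nnnorm]
    exact ⟨mod_cast this.1, mod_cast this.2⟩
  intro A hAb hA1 hAm
  set R := ‖x₀‖ with hR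
  have hR0 : 0 ≤ R := norm_nonneg _
  -- Chosen so that scaling a point of `A` (of norm at most `R + r₀/2`) by a factor in `(a, 1]`
  -- moves it by less than `r₀/2`; the truncated cone then stays in the ball where the flattening is
  -- controlled.
  set a : ℝ := 1 - r₀ / (2 * (R + r₀)) with ha_def
  have hfrac : r₀ / (2 * (R + r₀)) ≤ 1 / 2 := by
    rw [div_le_div_iff₀ (by positivity) (by positivity)]
    nlinarith
  have hfrac0 : 0 < r₀ / (2 * (R + r₀)) := by positivity
  have ha : 0 < a := by rw [ha_def]; linarith
  have ha1 : a < 1 := by rw [ha_def]; linarith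
  have hcone : levelCone g a A ⊆ ball x₀ r₀ := by
    rintro y ⟨hy1, hy2, hy3⟩
    have hgy : 0 < g y := ha.trans hy1
    have hx := hAb hy3
    set x := (g y)⁻¹ • y with hxdef
    have hyx : y = g y • x := by rw [hxdef, smul_inv_smul₀ hgy.ne']
    rw [mem_ball, dist_eq_norm] at hx ⊢
    have hxn : ‖x‖ ≤ R + r₀ / 2 := by
      have := norm_sub_norm_le x x₀
      linarith
    have e : y - x₀ = (x - x₀) - (1 - g y) • x := by
      rw [sub_smul, one_smul, ← hyx]; abel
    rw [e]
    have h5 : ‖(1 - g y) • x‖ ≤ r₀ / (2 * (R + r₀)) * (R + r₀) := by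
      rw [norm_smul, Real.norm_of_nonneg (by linarith)]
      gcongr
      · rw [ha_def] at hy1; linarith
      · linarith
    have h6 : r₀ / (2 * (R + r₀)) * (R + r₀) = r₀ / 2 := by field_simp
    calc _ ≤ ‖x - x₀‖ + ‖(1 - g y) • x‖ := norm_sub_le _ _
      _ < r₀ / 2 + r₀ / 2 := by linarith
      _ = r₀ := by ring
  have hgm : Measurable g := hg.continuous.measurable
  have hpm : Measurable fun x : E n => inner ℝ p x := by fun_prop
  have hAb' : A ⊆ ball x₀ r₀ := hAb.trans (ball_subset_ball (half_le_self hr₀.le))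
  have hbd : ∀ x ∈ ball x₀ r₀, ∀ y ∈ ball x₀ r₀, _ := fun x hx y hy =>
    dist_straighten_bounds hp hk' hl hx hy
  have hlip : LipschitzOnWith k (straighten g p) (ball x₀ r₀) :=
    LipschitzOnWith.of_dist_le_mul fun x hx y hy => (hbd x hx y hy).1
  have hinj : InjOn (straighten g p) (ball x₀ r₀) := fun x hx y hy hxy => by
    have := (hbd x hx y hy).2
    rw [hxy, dist_self, mul_zero] at this
    exact dist_le_zero.1 this
  set B := straighten g p '' A with hB
  have hBm : MeasurableSet B :=
    hAm.image_of_continuousOn_injOn (hlip.continuousOn.mono hAb') (hinj.mono hAb')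
  have hB1 : B ⊆ {x | inner ℝ p x = 1} := by
    rintro _ ⟨x, hx, rfl⟩
    exact (inner_straighten g hp x).trans (hA1 hx)
  have hBbdd : Bornology.IsBounded B := by
    have hsc : Continuous (straighten g p) := by
      have := hg.continuous
      unfold straighten
      fun_prop
    exact ((isCompact_closedBall x₀ (r₀ / 2)).image hsc).isBounded.subset
      (image_mono (hAb.trans ball_subset_closedBall))
  have hAbdd : Bornology.IsBounded A := isBounded_ball.subset hAb
  -- comparison of the cones
  have hvol : ∀ s : Set (E n), (μHE[n] : Measure (E n)) s = volume s := fun s => by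
    rw [EuclideanSpace.euclideanHausdorffMeasure_eq_volume]
  have hc1 : volume (levelCone (fun x => inner ℝ p x) a B) ≤
      (k : ℝ≥0∞) ^ n * volume (levelCone g a A) := by
    rw [hB, ← straighten_image_levelCone hg.posHomogeneous hp ha.le, ← hvol, ← hvol]
    exact (hlip.mono hcone).euclideanHausdorffMeasure_image_le n
  have hc2 : volume (levelCone g a A) ≤
      (k : ℝ≥0∞) ^ n * volume (levelCone (fun x => inner ℝ p x) a B) := by
    rw [hB, ← straighten_image_levelCone hg.posHomogeneous hp ha.le, ← hvol, ← hvol]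
    exact euclideanHausdorffMeasure_le_image
      (fun x hx y hy => (hbd x (hcone hx) y (hcone hy)).2) n
  -- The truncated cone has `1 - a ^ n` times the volume of the full one, so comparisons of
  -- truncated cones pass to full cones; finiteness permits the subtraction.
  have hcancel : ∀ {u v : ℝ≥0∞} {ua va : ℝ≥0∞}, u < ∞ → v < ∞ →
      u = ua + ENNReal.ofReal (a ^ n) * u → v = va + ENNReal.ofReal (a ^ n) * v →
      ua ≤ (k : ℝ≥0∞) ^ n * va → u ≤ (k : ℝ≥0∞) ^ n * v := by
    intro u v ua va hu hv hua hva h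
    have hlt : ENNReal.ofReal (a ^ n) < 1 := by
      rw [ENNReal.ofReal_lt_one]
      exact pow_lt_one₀ ha.le ha1 (by omega)
    have e : ∀ {w wa : ℝ≥0∞}, w < ∞ → w = wa + ENNReal.ofReal (a ^ n) * w →
        (1 - ENNReal.ofReal (a ^ n)) * w = wa := by
      intro w wa hw hwa
      rw [ENNReal.sub_mul (fun _ _ => hw.ne), one_mul]
      conv_lhs => rw [hwa]
      rw [← hwa]
      refine ENNReal.sub_eq_of_eq_add (ENNReal.mul_ne_top ENNReal.ofReal_ne_top hw.ne) hwa
    have h0 : 1 - ENNReal.ofReal (a ^ n) ≠ 0 := (tsub_pos_of_lt hlt).ne'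
    have ht : 1 - ENNReal.ofReal (a ^ n) ≠ ∞ := by simp
    rw [← ENNReal.mul_le_mul_iff_right h0 ht]
    calc _ = ua := e hu hua
      _ ≤ _ := h
      _ = (k : ℝ≥0∞) ^ n * ((1 - ENNReal.ofReal (a ^ n)) * v) := by rw [e hv hva]
      _ = _ := by ring
  have sA := volume_levelCone_eq_add hgm hg.posHomogeneous hAm ha ha1
  have sB := volume_levelCone_eq_add hpm (posHomogeneous_inner p) hBm ha ha1
  have fA := volume_levelCone_lt_top (φ := g) hAbdd
  have fB := volume_levelCone_lt_top (φ := fun x => inner ℝ p x) hBbdd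
  have hv1 := hcancel fB fA sB sA hc1
  have hv2 := hcancel fA fB sA sB hc2
  have hw1 : coneMeasure (fun x => inner ℝ p x) B ≤ (k : ℝ≥0∞) ^ n * coneMeasure g A := by
    rw [coneMeasure_apply hgm hAm, coneMeasure_apply hpm hBm, mul_left_comm]
    gcongr
  have hw2 : coneMeasure g A ≤ (k : ℝ≥0∞) ^ n * coneMeasure (fun x => inner ℝ p x) B := by
    rw [coneMeasure_apply hgm hAm, coneMeasure_apply hpm hBm, mul_left_comm]
    gcongr
  have hH1 : (μHE[n - 1] : Measure (E n)) B ≤ (k : ℝ≥0∞) ^ (n - 1) * (μHE[n - 1] : Measure (E n)) A :=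
    (hlip.mono hAb').euclideanHausdorffMeasure_image_le _
  have hH2 : (μHE[n - 1] : Measure (E n)) A ≤ (k : ℝ≥0∞) ^ (n - 1) * (μHE[n - 1] : Measure (E n)) B :=
    euclideanHausdorffMeasure_le_image (fun x hx y hy => (hbd x (hAb' hx) y (hAb' hy)).2) _
  have hflat := euclideanHausdorffMeasure_eq_coneMeasure_inner hn hp hBm hB1
  have hkp : (k : ℝ≥0∞) ^ (n - 1) ≤ (k : ℝ≥0∞) ^ n :=
    pow_le_pow_right₀ (by exact_mod_cast hk.le) (by omega)
  constructor
  · calc _ ≤ _ := hH2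
      _ ≤ (k : ℝ≥0∞) ^ n * (‖p‖ₑ * ((k : ℝ≥0∞) ^ n * coneMeasure g A)) := by
        rw [hflat]; gcongr
      _ = _ := by ring
  · calc _ ≤ ‖p‖ₑ * ((k : ℝ≥0∞) ^ n * coneMeasure (fun x => inner ℝ p x) B) := by gcongr
      _ = (k : ℝ≥0∞) ^ n * (μHE[n - 1] : Measure (E n)) B := by rw [hflat]; ring
      _ ≤ (k : ℝ≥0∞) ^ n * ((k : ℝ≥0∞) ^ n * (μHE[n - 1] : Measure (E n)) A) := by
        gcongr; exact hH1.trans (by gcongr)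
      _ = _ := by ring

lemma volume_not_differentiableAt (hg : IsConvexGauge g) :
    volume {x | ¬ DifferentiableAt ℝ g x} = 0 :=
  hg.lip.choose_spec.ae_differentiableAt

/-- The singular points of the level set are negligible for the Hausdorff measure. -/
lemma euclideanHausdorffMeasure_singular (hg : IsConvexGauge g) (hn : 1 ≤ n) :
    (μHE[n - 1] : Measure (E n)) {x | g x = 1 ∧ ¬ DifferentiableAt ℝ g x} = 0 := by
  refine measure_null_of_locally_null _ fun x₀ hx₀ => ?_
  have hx0 : x₀ ≠ 0 := hg.ne_zero_of_eq_one hx₀.1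
  have hx2 : ‖x₀‖ ^ 2 ≠ 0 := by simpa using hx0
  -- The hyperplane `inner ℝ p x = 1` passes through `x₀`. The points of nondifferentiability other
  -- than the origin form a cone, null by Rademacher, so its trace `T` on this hyperplane is null by
  -- the flat formula. Radial projection, Lipschitz near `x₀`, carries `T` onto the nearby singular
  -- points of the level set.
  set p : E n := (‖x₀‖ ^ 2)⁻¹ • x₀ with hp_def
  have hp : p ≠ 0 := by simp [hp_def, hx0]
  have hpx : inner ℝ p x₀ = 1 := by
    rw [hp_def, inner_smul_left, real_inner_self_eq_norm_sq, RCLike.conj_to_real,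
      inv_mul_cancel₀ hx2]
  have hpm : Measurable fun x : E n => inner ℝ p x := by fun_prop
  set T : Set (E n) := {z | inner ℝ p z = 1 ∧ ¬ DifferentiableAt ℝ g z} with hT
  have hTm : MeasurableSet T :=
    (measurableSet_eq_fun hpm measurable_const).inter (measurableSet_of_differentiableAt ℝ g).compl
  have hT0 : (μHE[n - 1] : Measure (E n)) T = 0 := by
    rw [euclideanHausdorffMeasure_eq_coneMeasure_inner hn hp hTm fun x hx => hx.1,
      coneMeasure_apply hpm hTm]
    have : volume (levelCone (fun x => inner ℝ p x) 0 T) = 0 := by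
      refine measure_mono_null ?_ hg.volume_not_differentiableAt
      rintro y ⟨hy0, -, hy⟩ hyd
      exact hy.2 (hg.differentiableAt_smul (inv_pos.2 hy0) hyd)
    simp [this]
  obtain ⟨L, hL⟩ := hg.lip
  -- the radial projection to the level set is Lipschitz near `x₀`
  obtain ⟨ρ, hρ, hball⟩ : ∃ ρ > 0, ∀ z ∈ ball x₀ ρ, 1 / 2 < g z := by
    have : ∀ᶠ z in 𝓝 x₀, 1 / 2 < g z :=
      hg.continuous.continuousAt.eventually (lt_mem_nhds (by rw [hx₀.1]; norm_num))
    exact Metric.eventually_nhds_iff_ball.1 this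
  set R := ‖x₀‖ + ρ with hR
  have hlip : LipschitzOnWith (2 + 4 * L * R.toNNReal) (fun z => (g z)⁻¹ • z) (ball x₀ ρ) := by
    refine LipschitzOnWith.of_dist_le_mul fun y hy z hz => ?_
    have hgy := hball y hy
    have hgz := hball z hz
    have hzn : ‖z‖ ≤ R := by
      have := norm_sub_norm_le z x₀
      rw [mem_ball, dist_eq_norm] at hz
      linarith
    have hgd := hL.dist_le_mul y z
    rw [Real.dist_eq] at hgd
    have e : (g y)⁻¹ • y - (g z)⁻¹ • z = (g y)⁻¹ • (y - z) + ((g z - g y) / (g y * g z)) • z := by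
      have : (g z - g y) / (g y * g z) = (g y)⁻¹ - (g z)⁻¹ := by
        have := (by linarith : g y ≠ 0); have := (by linarith : g z ≠ 0)
        field_simp
      rw [this, smul_sub, sub_smul]; abel
    rw [dist_eq_norm, e]
    have i1 : (g y)⁻¹ ≤ 2 := by
      rw [inv_le_comm₀ (by linarith) (by norm_num)]; linarith
    have i2 : |(g z - g y) / (g y * g z)| ≤ 4 * (L * dist y z) := by
      rw [abs_div, abs_of_pos (show 0 < g y * g z by nlinarith), div_le_iff₀ (by nlinarith),
        abs_sub_comm]
      have h4 : 1 / 4 ≤ g y * g z := by nlinarith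
      have h5 : (0 : ℝ) ≤ L * dist y z := by positivity
      nlinarith
    have hR0 : 0 ≤ R := (norm_nonneg z).trans hzn
    push_cast [Real.coe_toNNReal R hR0]
    calc _ ≤ ‖(g y)⁻¹ • (y - z)‖ + ‖((g z - g y) / (g y * g z)) • z‖ := norm_add_le _ _
      _ ≤ 2 * dist y z + 4 * (L * dist y z) * R := by
        rw [norm_smul, norm_smul, Real.norm_of_nonneg (by positivity), Real.norm_eq_abs,
          ← dist_eq_norm]
        gcongr
      _ = _ := by ring
  have hcont : ContinuousAt (fun y : E n => (inner ℝ p y : ℝ)⁻¹ • y) x₀ := by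
    have h1 : ContinuousAt (fun y : E n => (inner ℝ p y : ℝ)) x₀ := by fun_prop
    exact (h1.inv₀ (by rw [hpx]; exact one_ne_zero)).smul continuousAt_id
  have hnear : ∀ᶠ y in 𝓝 x₀, (inner ℝ p y : ℝ)⁻¹ • y ∈ ball x₀ ρ ∧ 0 < inner ℝ p y := by
    refine (hcont.eventually ?_).and ?_
    · change ∀ᶠ y in 𝓝 ((inner ℝ p x₀ : ℝ)⁻¹ • x₀), y ∈ ball x₀ ρ
      rw [hpx, inv_one, one_smul]
      exact ball_mem_nhds _ hρ
    · have : ContinuousAt (fun y : E n => (inner ℝ p y : ℝ)) x₀ := by fun_prop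
      exact this.eventually (lt_mem_nhds (by simp only [hpx]; norm_num))
  refine ⟨{y | g y = 1 ∧ ¬ DifferentiableAt ℝ g y} ∩
    {y | (inner ℝ p y : ℝ)⁻¹ • y ∈ ball x₀ ρ ∧ 0 < inner ℝ p y}, ?_, ?_⟩
  · exact inter_mem_nhdsWithin _ hnear
  have hsub : {y | g y = 1 ∧ ¬ DifferentiableAt ℝ g y} ∩
      {y | (inner ℝ p y : ℝ)⁻¹ • y ∈ ball x₀ ρ ∧ 0 < inner ℝ p y} ⊆
      (fun z => (g z)⁻¹ • z) '' (T ∩ ball x₀ ρ) := by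
    rintro y ⟨⟨hy1, hyd⟩, hyb, hyp⟩
    refine ⟨_, ⟨⟨?_, ?_⟩, hyb⟩, ?_⟩
    · rw [inner_smul_right, inv_mul_cancel₀ hyp.ne']
    · intro h
      have := hg.differentiableAt_smul hyp h
      rw [smul_inv_smul₀ hyp.ne'] at this
      exact hyd this
    · simp only
      rw [hg.smul _ _ (inv_pos.2 hyp).le, hy1, mul_one, inv_inv, smul_inv_smul₀ hyp.ne']
  refine measure_mono_null hsub (le_antisymm ?_ zero_le)
  refine ((hlip.mono inter_subset_right).euclideanHausdorffMeasure_image_le _).trans ?_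
  rw [measure_mono_null inter_subset_left hT0, mul_zero]

end IsConvexGauge

/-- A measure inequality can be checked locally. -/
lemma measure_le_of_locally_le {X : Type*} [TopologicalSpace X] [SecondCountableTopology X]
    [MeasurableSpace X] [OpensMeasurableSpace X] {μ ν : Measure X} {s : Set X}
    (hs : MeasurableSet s)
    (h : ∀ x ∈ s, ∃ U, IsOpen U ∧ x ∈ U ∧ ∀ A ⊆ U, A ⊆ s → MeasurableSet A → μ A ≤ ν A) :
    μ s ≤ ν s := by
  choose! U hUo hxU hU using h
  obtain ⟨t, hts, htc, hst⟩ := TopologicalSpace.countable_cover_nhdsWithin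
    (f := U) (s := s) fun x hx => mem_nhdsWithin_of_mem_nhds ((hUo x hx).mem_nhds (hxU x hx))
  rcases t.eq_empty_or_nonempty with rfl | hne
  · have : s = ∅ := by simpa using hst
    simp [this]
  obtain ⟨f, rfl⟩ := htc.exists_eq_range hne
  rw [biUnion_range] at hst
  set D := disjointed fun i => U (f i) with hD
  have hDm : ∀ i, MeasurableSet (s ∩ D i) := fun i =>
    hs.inter (MeasurableSet.disjointed (fun i => (hUo _ (hts ⟨i, rfl⟩)).measurableSet) i)
  have hdis : Pairwise (Function.onFun Disjoint fun i => s ∩ D i) := fun i j hij =>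
    ((disjoint_disjointed _ hij).mono inter_subset_right inter_subset_right)
  have hsD : s = ⋃ i, s ∩ D i := by
    rw [← inter_iUnion, iUnion_disjointed]
    exact (inter_eq_left.2 hst).symm
  rw [hsD, measure_iUnion hdis hDm, measure_iUnion hdis hDm]
  refine ENNReal.tsum_le_tsum fun i => ?_
  exact hU (f i) (hts ⟨i, rfl⟩) _ (inter_subset_right.trans (disjointed_subset _ _))
    inter_subset_left (hDm i)

namespace IsConvexGauge

/-- The surface area formula: on the level set `g = 1`, the Hausdorff measure has density
`‖∇ g‖` with respect to the cone measure. -/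
theorem restrict_euclideanHausdorffMeasure (hg : IsConvexGauge g) (hn : 1 ≤ n) :
    (μHE[n - 1] : Measure (E n)).restrict {x | g x = 1} =
      (coneMeasure g).withDensity fun x => ‖gradient g x‖ₑ := by
  have hgm : Measurable g := hg.continuous.measurable
  have hS1 : MeasurableSet {x | g x = 1} := measurableSet_eq_fun hgm measurable_const
  have hDm : MeasurableSet {x | DifferentiableAt ℝ g x} := measurableSet_of_differentiableAt ℝ g
  have hgrad : Measurable fun x => ‖gradient g x‖ₑ := (measurable_gradient g).enorm
  have hreg : ∀ A ⊆ {x | g x = 1}, A ⊆ {x | DifferentiableAt ℝ g x} → MeasurableSet A →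
      (μHE[n - 1] : Measure (E n)) A = (coneMeasure g).withDensity (fun x => ‖gradient g x‖ₑ) A := by
    intro A hA1 hAd hAm
    -- The exponent is `2 * n` from the local comparison plus one for replacing the frozen
    -- `‖gradient g x₀‖` by `‖gradient g x‖`. Letting `k` decrease to `1` gives equality.
    have key : ∀ k : ℝ≥0, 1 < k →
        (μHE[n - 1] : Measure (E n)) A ≤ ((k : ℝ≥0∞) ^ (2 * n + 1) •
          (coneMeasure g).withDensity (fun x => ‖gradient g x‖ₑ)) A ∧
        (coneMeasure g).withDensity (fun x => ‖gradient g x‖ₑ) A ≤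
          ((k : ℝ≥0∞) ^ (2 * n + 1) • (μHE[n - 1] : Measure (E n))) A := by
      intro k hk
      constructor
      all_goals
        refine measure_le_of_locally_le hAm fun x₀ hx₀ => ?_
        obtain ⟨r, hr, hgr, hcmp⟩ := hg.exists_ball_compare hn (hA1 hx₀) (hAd hx₀) hk
        refine ⟨ball x₀ r, isOpen_ball, mem_ball_self hr, fun B hB hBA hBm => ?_⟩
        obtain ⟨c1, c2⟩ := hcmp B hB (hBA.trans hA1) hBm
        rw [Measure.smul_apply, smul_eq_mul, withDensity_apply _ hBm]
      · calc _ ≤ _ := c1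
          _ = (k : ℝ≥0∞) ^ (2 * n) * ∫⁻ _ in B, ‖gradient g x₀‖ₑ ∂coneMeasure g := by
            rw [setLIntegral_const]
          _ ≤ (k : ℝ≥0∞) ^ (2 * n) * ∫⁻ x in B, k * ‖gradient g x‖ₑ ∂coneMeasure g := by
            gcongr _ * ?_
            exact setLIntegral_mono' hBm fun x hx => (hgr x (hB hx) (hAd (hBA hx))).2
          _ = _ := by rw [lintegral_const_mul _ hgrad]; ring
      · calc _ ≤ ∫⁻ _ in B, k * ‖gradient g x₀‖ₑ ∂coneMeasure g :=
              setLIntegral_mono' hBm fun x hx => (hgr x (hB hx) (hAd (hBA hx))).1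
          _ = k * (‖gradient g x₀‖ₑ * coneMeasure g B) := by rw [setLIntegral_const]; ring
          _ ≤ k * ((k : ℝ≥0∞) ^ (2 * n) * (μHE[n - 1] : Measure (E n)) B) := by gcongr
          _ = _ := by ring
    have hlim : ∀ u v : ℝ≥0∞, (∀ k : ℝ≥0, 1 < k → u ≤ (k : ℝ≥0∞) ^ (2 * n + 1) * v) → u ≤ v := by
      intro u v h
      have ht : Tendsto (fun k : ℝ≥0 => (k : ℝ≥0∞) ^ (2 * n + 1) * v) (𝓝[>] 1) (𝓝 (1 * v)) := by
        refine ENNReal.Tendsto.mul_const ?_ (Or.inl one_ne_zero)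
        have : Continuous fun k : ℝ≥0 => (k : ℝ≥0∞) ^ (2 * n + 1) := by fun_prop
        simpa using (this.tendsto 1).mono_left nhdsWithin_le_nhds
      rw [one_mul] at ht
      refine ge_of_tendsto ht ?_
      filter_upwards [self_mem_nhdsWithin] with k hk using h k hk
    refine le_antisymm (hlim _ _ fun k hk => ?_) (hlim _ _ fun k hk => ?_)
    · simpa using (key k hk).1
    · simpa using (key k hk).2
  have hcone0 : ∀ A : Set (E n), MeasurableSet A →
      A ⊆ {x | g x = 1 ∧ DifferentiableAt ℝ g x}ᶜ → coneMeasure g A = 0 := by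
    intro A hAm hA
    rw [coneMeasure_apply hgm hAm]
    have : volume (levelCone g 0 A) = 0 := by
      refine measure_mono_null ?_ hg.volume_not_differentiableAt
      rintro y ⟨hy0, -, hy⟩ hyd
      refine hA hy ⟨?_, hg.differentiableAt_smul (inv_pos.2 hy0) hyd⟩
      rw [hg.smul _ _ (inv_pos.2 hy0).le, inv_mul_cancel₀ hy0.ne']
    simp [this]
  ext A hA
  have hGm : MeasurableSet {x | g x = 1 ∧ DifferentiableAt ℝ g x} := hS1.inter hDm
  rw [← measure_inter_add_sdiff A hGm,
    ← measure_inter_add_sdiff (μ := (coneMeasure g).withDensity _) A hGm]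
  congr 1
  · rw [Measure.restrict_apply (hA.inter hGm), inter_eq_left.2 fun x hx => hx.2.1]
    exact hreg _ (fun x hx => hx.2.1) (fun x hx => hx.2.2) (hA.inter hGm)
  · rw [Measure.restrict_apply (hA.diff hGm), withDensity_apply _ (hA.diff hGm),
      Measure.restrict_eq_zero.2 (hcone0 _ (hA.diff hGm) fun x hx => hx.2), lintegral_zero_measure]
    refine measure_mono_null ?_ (hg.euclideanHausdorffMeasure_singular hn)
    rintro x ⟨⟨hxA, hx⟩, hx1⟩
    exact ⟨hx1, fun h => hx ⟨hx1, h⟩⟩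

/-- Differentiability is constant along open rays, so Rademacher's theorem for volume passes to the
cone measure. -/
lemma coneMeasure_ae (hg : IsConvexGauge g) :
    ∀ᵐ x ∂coneMeasure g, g x = 1 ∧ DifferentiableAt ℝ g x := by
  have hgm : Measurable g := hg.continuous.measurable
  have hGm : MeasurableSet {x | g x = 1 ∧ DifferentiableAt ℝ g x} :=
    (measurableSet_eq_fun hgm measurable_const).inter (measurableSet_of_differentiableAt ℝ g)
  rw [ae_iff]
  change coneMeasure g {x | g x = 1 ∧ DifferentiableAt ℝ g x}ᶜ = 0
  rw [coneMeasure_apply hgm hGm.compl]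
  have : volume (levelCone g 0 {x | g x = 1 ∧ DifferentiableAt ℝ g x}ᶜ) = 0 := by
    refine measure_mono_null ?_ hg.volume_not_differentiableAt
    rintro y ⟨hy0, -, hy⟩ hyd
    refine hy ⟨?_, hg.differentiableAt_smul (inv_pos.2 hy0) hyd⟩
    rw [hg.smul _ _ (inv_pos.2 hy0).le, inv_mul_cancel₀ hy0.ne']
  simp [this]

end IsConvexGauge

end SurfaceArea

/-! ### Polar coordinates adapted to a gauge -/

section Polar

variable {n : ℕ} {g : E n → ℝ}

lemma nontrivial_E (hn : 1 ≤ n) : Nontrivial (E n) := by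
  have : Nonempty (Fin n) := ⟨⟨0, hn⟩⟩
  infer_instance

/-- Integration in polar coordinates. -/
lemma lintegral_eq_lintegral_sphere (hn : 1 ≤ n) {F : E n → ℝ≥0∞} (hF : Measurable F) :
    ∫⁻ x, F x = ∫⁻ u : UnitSphere n, (∫⁻ r in Ioi (0 : ℝ),
      F (r • (u : E n)) * ENNReal.ofReal (r ^ (n - 1))) ∂(volume : Measure (E n)).toSphere := by
  have := nontrivial_E hn
  have hmp := (volume : Measure (E n)).measurePreserving_homeomorphUnitSphereProd
  rw [finrank_euclideanSpace_fin] at hmp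
  calc ∫⁻ x, F x = ∫⁻ x in ({0}ᶜ : Set (E n)), F x := by rw [restrict_compl_singleton]
    _ = ∫⁻ x : ({0}ᶜ : Set (E n)), F x ∂((volume : Measure (E n)).comap (↑)) := by
      rw [lintegral_subtype_comap (measurableSet_singleton _).compl]
    _ = ∫⁻ q : UnitSphere n × Ioi (0 : ℝ), F (q.2.1 • (q.1 : E n))
          ∂((volume : Measure (E n)).toSphere.prod (Measure.volumeIoiPow (n - 1))) := by
      rw [← hmp.lintegral_comp_emb (Homeomorph.measurableEmbedding _)]
      refine lintegral_congr fun x => ?_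
      have hx : ‖(x : E n)‖ ≠ 0 := norm_ne_zero_iff.2 x.2
      simp [smul_smul, hx]
    _ = ∫⁻ u : UnitSphere n, (∫⁻ r : Ioi (0 : ℝ), F (r.1 • (u : E n))
          ∂(Measure.volumeIoiPow (n - 1))) ∂(volume : Measure (E n)).toSphere := by
      rw [lintegral_prod]
      refine (hF.comp ?_).aemeasurable
      fun_prop
    _ = _ := by
      refine lintegral_congr fun u => ?_
      have hFu : Measurable fun r : Ioi (0 : ℝ) => F (r.1 • (u : E n)) := hF.comp (by fun_prop)
      rw [Measure.volumeIoiPow, lintegral_withDensity_eq_lintegral_mul _ (by fun_prop) hFu,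
        ← lintegral_subtype_comap measurableSet_Ioi]
      refine lintegral_congr fun r => ?_
      simp [mul_comm]

lemma lintegral_Ioi_mul_pow (hn : 1 ≤ n) {c : ℝ} (hc : 0 < c) {f : ℝ → ℝ≥0∞} (hf : Measurable f) :
    ∫⁻ r in Ioi (0 : ℝ), f r * ENNReal.ofReal (r ^ (n - 1)) =
      ENNReal.ofReal (c ^ n) * ∫⁻ s in Ioi (0 : ℝ), f (c * s) * ENNReal.ofReal (s ^ (n - 1)) := by
  have hm : Measurable fun r : ℝ => f r * ENNReal.ofReal (r ^ (n - 1)) := by fun_prop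
  rw [← lintegral_indicator measurableSet_Ioi, ← lintegral_indicator measurableSet_Ioi]
  conv_lhs => rw [← Real.smul_map_volume_mul_left hc.ne']
  rw [lintegral_smul_measure, lintegral_map (hm.indicator measurableSet_Ioi) (by fun_prop),
    smul_eq_mul, abs_of_pos hc, ← lintegral_const_mul' _ _ ENNReal.ofReal_ne_top,
    ← lintegral_const_mul' _ _ ENNReal.ofReal_ne_top]
  refine lintegral_congr fun s => ?_
  by_cases hs : s ∈ Ioi (0 : ℝ)
  · have hs' : 0 < s := hs
    rw [indicator_of_mem (show c * s ∈ Ioi (0 : ℝ) from mul_pos hc hs), indicator_of_mem hs,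
      mul_pow, ENNReal.ofReal_mul (by positivity)]
    have e : ENNReal.ofReal (c ^ n) = ENNReal.ofReal c * ENNReal.ofReal (c ^ (n - 1)) := by
      rw [← ENNReal.ofReal_mul hc.le, ← pow_succ', Nat.sub_add_cancel hn]
    rw [e]; ring
  · have hs' : s ≤ 0 := not_lt.1 hs
    rw [indicator_of_notMem (show c * s ∉ Ioi (0 : ℝ) from
      not_lt.2 (mul_nonpos_of_nonneg_of_nonpos hc.le hs')), indicator_of_notMem hs, mul_zero,
      mul_zero]

namespace IsConvexGauge

/-- Integration in polar coordinates adapted to the level set `g = 1`. -/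
theorem lintegral_eq_lintegral_coneMeasure (hg : IsConvexGauge g) (hn : 1 ≤ n)
    {F : E n → ℝ≥0∞} (hF : Measurable F) :
    ∫⁻ x, F x = ∫⁻ x, (∫⁻ s in Ioi (0 : ℝ), F (s • x) * ENNReal.ofReal (s ^ (n - 1)))
      ∂coneMeasure g := by
  have hgm : Measurable g := hg.continuous.measurable
  set Φ : E n → ℝ≥0∞ := fun x => ∫⁻ s in Ioi (0 : ℝ), F (s • x) * ENNReal.ofReal (s ^ (n - 1))
    with hΦ
  have hΦm : Measurable Φ := by
    refine Measurable.lintegral_prod_right' (f := fun q : E n × ℝ =>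
      F (q.2 • q.1) * ENNReal.ofReal (q.2 ^ (n - 1))) ?_
    exact (hF.comp (by fun_prop)).mul (by fun_prop)
  have hrad : Measurable fun x : E n => (g x)⁻¹ • x := hgm.inv.smul measurable_id
  have hSm : MeasurableSet {x | 0 < g x ∧ g x ≤ 1} :=
    (measurableSet_lt measurable_const hgm).inter (measurableSet_le hgm measurable_const)
  have hpos : ∀ u : UnitSphere n, 0 < g (u : E n) := fun u => by
    refine hg.pos _ fun h => ?_
    have := mem_sphere_zero_iff_norm.1 u.2
    rw [h, norm_zero] at this
    exact zero_ne_one this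
  have hn0 : (n : ℝ≥0∞) ≠ 0 := by exact_mod_cast (by omega : n ≠ 0)
  have hΦr : Measurable fun x : E n => Φ ((g x)⁻¹ • x) := hΦm.comp hrad
  -- In ordinary polar coordinates the cone measure has density `(g u)⁻¹ ^ n` on the sphere, exactly
  -- the Jacobian of rescaling the ray through `u` to reach the level set at parameter 1.
  have hR : ∫⁻ x, Φ x ∂coneMeasure g =
      ∫⁻ u : UnitSphere n, ENNReal.ofReal ((g u)⁻¹ ^ n) * Φ ((g u)⁻¹ • (u : E n))
        ∂(volume : Measure (E n)).toSphere := by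
    rw [coneMeasure, lintegral_smul_measure, lintegral_map hΦm hrad,
      ← lintegral_indicator hSm, lintegral_eq_lintegral_sphere hn
        (hΦr.indicator hSm), smul_eq_mul]
    have step : ∀ u : UnitSphere n, (∫⁻ r in Ioi (0 : ℝ),
        {x | 0 < g x ∧ g x ≤ 1}.indicator (fun x => Φ ((g x)⁻¹ • x)) (r • (u : E n)) *
          ENNReal.ofReal (r ^ (n - 1))) =
        (n : ℝ≥0∞)⁻¹ * (ENNReal.ofReal ((g u)⁻¹ ^ n) * Φ ((g u)⁻¹ • (u : E n))) := by
      intro u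
      have hu := hpos u
      -- The integrand is constant along the ray up to the level set and vanishes beyond it; the
      -- radial integral `1 / n` then cancels the normalizing factor.
      set f : ℝ → ℝ≥0∞ := (Iic (g u)⁻¹).indicator fun _ => Φ ((g u)⁻¹ • (u : E n)) with hf
      have h1 : (∫⁻ r in Ioi (0 : ℝ),
          {x | 0 < g x ∧ g x ≤ 1}.indicator (fun x => Φ ((g x)⁻¹ • x)) (r • (u : E n)) *
            ENNReal.ofReal (r ^ (n - 1))) =
          ∫⁻ r in Ioi (0 : ℝ), f r * ENNReal.ofReal (r ^ (n - 1)) := by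
        refine setLIntegral_congr_fun measurableSet_Ioi fun r (hr : 0 < r) => ?_
        congr 1
        have hgr : g (r • (u : E n)) = r * g u := hg.smul _ _ hr.le
        by_cases hle : r ≤ (g u)⁻¹
        · have hmem : r • (u : E n) ∈ {x | 0 < g x ∧ g x ≤ 1} := by
            refine ⟨by rw [hgr]; positivity, ?_⟩
            rw [hgr]
            rwa [le_inv_comm₀ hr hu, ← one_div, le_div_iff₀ hr, mul_comm] at hle
          rw [indicator_of_mem hmem, hf, indicator_of_mem (by exact hle), hgr,
            smul_smul]
          congr 2
          field_simp
        · have hmem : r • (u : E n) ∉ {x | 0 < g x ∧ g x ≤ 1} := by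
            rintro ⟨-, h⟩
            apply hle
            rw [hgr] at h
            rwa [le_inv_comm₀ hr hu, ← one_div, le_div_iff₀ hr, mul_comm]
          rw [indicator_of_notMem hmem, hf, indicator_of_notMem (by exact hle)]
      rw [h1, lintegral_Ioi_mul_pow hn (inv_pos.2 hu) (measurable_const.indicator measurableSet_Iic)]
      have h2 : (∫⁻ s in Ioi (0 : ℝ), f ((g u)⁻¹ * s) * ENNReal.ofReal (s ^ (n - 1))) =
          (n : ℝ≥0∞)⁻¹ * Φ ((g u)⁻¹ • (u : E n)) := by
        rw [← lintegral_Ioc_pow hn, ← lintegral_mul_const _ (by fun_prop),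
          ← lintegral_indicator measurableSet_Ioi, ← lintegral_indicator measurableSet_Ioc]
        refine lintegral_congr fun s => ?_
        by_cases hs : 0 < s
        · rw [indicator_of_mem (show s ∈ Ioi (0 : ℝ) from hs)]
          by_cases hs1 : s ≤ 1
          · rw [indicator_of_mem (show s ∈ Ioc (0 : ℝ) 1 from ⟨hs, hs1⟩), hf, indicator_of_mem, mul_comm]
            exact mul_le_of_le_one_right (inv_pos.2 hu).le hs1
          · rw [indicator_of_notMem (show s ∉ Ioc (0 : ℝ) 1 from fun h => hs1 h.2), hf,
              indicator_of_notMem, zero_mul]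
            intro h
            exact hs1 (le_of_mul_le_mul_left (by rw [mul_one]; exact h) (inv_pos.2 hu))
        · rw [indicator_of_notMem (show s ∉ Ioi (0 : ℝ) from hs),
            indicator_of_notMem (show s ∉ Ioc (0 : ℝ) 1 from fun h => hs h.1)]
      rw [h2]; ring
    simp_rw [step]
    rw [lintegral_const_mul', ← mul_assoc, ENNReal.mul_inv_cancel hn0 (by simp), one_mul]
    exact ENNReal.inv_ne_top.2 hn0
  rw [hR, lintegral_eq_lintegral_sphere hn hF]
  refine lintegral_congr fun u => ?_
  rw [lintegral_Ioi_mul_pow hn (inv_pos.2 (hpos u)) (f := fun r => F (r • (u : E n)))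
    (hF.comp (by fun_prop)), hΦ]
  simp only [smul_smul, mul_comm]

end IsConvexGauge

end Polar

/-! ### Support functions, unit normals and the Gaussian surface area -/

section Normals

variable {n : ℕ} {g : E n → ℝ} {K : ConvexBody (E n)}

/-! ### Support functions -/

lemma bddAbove_inner_image (K : ConvexBody (E n)) (y : E n) :
    BddAbove ((fun x : E n => (inner ℝ x y : ℝ)) '' (K : Set (E n))) :=
  (K.isCompact.image (by fun_prop)).bddAbove

lemma inner_le_supportFunction {x : E n} (hx : x ∈ K) (y : E n) :
    inner ℝ x y ≤ supportFunction K y :=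
  le_csSup (bddAbove_inner_image K y) ⟨x, hx, rfl⟩

lemma supportFunction_le {y : E n} {c : ℝ} (h : ∀ x ∈ K, inner ℝ x y ≤ c) :
    supportFunction K y ≤ c := by
  refine csSup_le (K.nonempty.image _) ?_
  rintro _ ⟨x, hx, rfl⟩
  exact h x hx

lemma continuous_supportFunction (K : ConvexBody (E n)) : Continuous (supportFunction K) := by
  obtain ⟨R, hR⟩ := K.isBounded.exists_norm_le
  have hR0 : 0 ≤ R := (norm_nonneg _).trans (hR _ K.nonempty.some_mem)
  have h : ∀ y z, supportFunction K y - supportFunction K z ≤ R * dist y z := by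
    intro y z
    rw [sub_le_iff_le_add]
    refine supportFunction_le fun x hx => ?_
    have h1 := inner_le_supportFunction hx z
    have h2 : inner ℝ x (y - z) ≤ R * dist y z := by
      refine (real_inner_le_norm _ _).trans ?_
      rw [dist_eq_norm]
      gcongr
      exact hR x hx
    rw [inner_sub_right] at h2
    linarith
  refine (LipschitzWith.of_dist_le_mul (K := R.toNNReal) fun y z => ?_).continuous
  rw [Real.coe_toNNReal _ hR0, Real.dist_eq, abs_sub_le_iff]
  exact ⟨h y z, dist_comm y z ▸ h z y⟩

/-! ### Bodies with the origin in the interior -/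

lemma zero_mem_interior (hK : IsOriginSymmetricBody K) : (0 : E n) ∈ interior (K : Set (E n)) := by
  obtain ⟨⟨x, hx⟩, hsymm⟩ := hK
  have hneg : -x ∈ interior (K : Set (E n)) := by
    have h1 : -(K : Set (E n)) = K := by
      ext y
      exact ⟨fun h => by simpa using hsymm _ h, fun h => hsymm _ h⟩
    have h2 : -interior (K : Set (E n)) = interior (K : Set (E n)) := by
      have := (Homeomorph.neg (E n)).preimage_interior (K : Set (E n))
      simpa [h1] using this
    rw [← h2]
    simpa using hx
  have := K.convex.interior hx hneg (show (0 : ℝ) ≤ 1 / 2 by norm_num)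
    (show (0 : ℝ) ≤ 1 / 2 by norm_num) (by norm_num)
  simpa using this

lemma isConvexGauge_gauge (h0 : (0 : E n) ∈ interior (K : Set (E n))) :
    IsConvexGauge (gauge (K : Set (E n))) where
  smul r x hr := by
    rw [gauge_smul_of_nonneg hr, smul_eq_mul]
  add_le := gauge_add_le K.convex (absorbent_nhds_zero (mem_interior_iff_mem_nhds.1 h0))
  pos x hx := (gauge_pos (absorbent_nhds_zero (mem_interior_iff_mem_nhds.1 h0))
    (NormedSpace.isVonNBounded_of_isBounded ℝ K.isBounded)).2 hx
  lip := K.convex.lipschitz_gauge (mem_interior_iff_mem_nhds.1 h0)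

lemma gauge_le_one_iff_mem (h0 : (0 : E n) ∈ interior (K : Set (E n))) {x : E n} :
    gauge (K : Set (E n)) x ≤ 1 ↔ x ∈ K := by
  rw [gauge_le_one_iff_mem_closure K.convex (mem_interior_iff_mem_nhds.1 h0),
    K.isClosed.closure_eq, SetLike.mem_coe]

lemma gauge_eq_one_iff (h0 : (0 : E n) ∈ interior (K : Set (E n))) {x : E n} :
    gauge (K : Set (E n)) x = 1 ↔ x ∈ frontier (K : Set (E n)) :=
  gauge_eq_one_iff_mem_frontier K.convex (mem_interior_iff_mem_nhds.1 h0)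

lemma inner_le_supportFunction_mul_gauge (h0 : (0 : E n) ∈ interior (K : Set (E n))) (x y : E n) :
    inner ℝ x y ≤ supportFunction K y * gauge (K : Set (E n)) x := by
  have hg := isConvexGauge_gauge h0
  rcases eq_or_ne x 0 with rfl | hx
  · simp
  have hpos := hg.pos x hx
  have hmem : (gauge (K : Set (E n)) x)⁻¹ • x ∈ K := by
    rw [← gauge_le_one_iff_mem h0, hg.smul _ _ (inv_pos.2 hpos).le, inv_mul_cancel₀ hpos.ne']
  have := inner_le_supportFunction hmem y
  rw [inner_smul_left, RCLike.conj_to_real, inv_mul_le_iff₀ hpos, mul_comm] at this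
  exact this

lemma supportFunction_pos (h0 : (0 : E n) ∈ interior (K : Set (E n))) {y : E n} (hy : y ≠ 0) :
    0 < supportFunction K y := by
  have h1 := inner_le_supportFunction_mul_gauge h0 y y
  rw [real_inner_self_eq_norm_sq] at h1
  have h2 := (isConvexGauge_gauge h0).pos y hy
  have h3 : 0 < ‖y‖ ^ 2 := by positivity
  by_contra h
  nlinarith

lemma coe_sphere_ne_zero (v : UnitSphere n) : (v : E n) ≠ 0 := fun h => by
  have := mem_sphere_zero_iff_norm.1 v.2
  rw [h, norm_zero] at this
  exact zero_ne_one this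

lemma norm_coe_sphere (v : UnitSphere n) : ‖(v : E n)‖ = 1 := mem_sphere_zero_iff_norm.1 v.2

/-! ### Normal vectors -/

/-- The unit vector in the direction of the gradient, with the value `v₀` where it vanishes. -/
def unitNormal (v₀ : UnitSphere n) (g : E n → ℝ) (x : E n) : UnitSphere n :=
  ⟨if gradient g x = 0 then (v₀ : E n) else ‖gradient g x‖⁻¹ • gradient g x, by
    split_ifs with h
    · exact v₀.2
    · rw [mem_sphere_zero_iff_norm, norm_smul, norm_inv, norm_norm,
        inv_mul_cancel₀ (norm_ne_zero_iff.2 h)]⟩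

lemma measurable_unitNormal (v₀ : UnitSphere n) (g : E n → ℝ) : Measurable (unitNormal v₀ g) := by
  have hm := measurable_gradient g
  refine Measurable.subtype_mk (Measurable.ite ?_ measurable_const ?_)
  · exact hm (measurableSet_singleton 0)
  · exact hm.norm.inv.smul hm

lemma gradient_eq_smul_unitNormal (v₀ : UnitSphere n) (g : E n → ℝ) (x : E n) :
    gradient g x = ‖gradient g x‖ • (unitNormal v₀ g x : E n) := by
  by_cases h : gradient g x = 0
  · simp [h]
  · simp only [unitNormal, if_neg h]
    rw [smul_inv_smul₀ (norm_ne_zero_iff.2 h)]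

/-- The function `h_K(v) * gauge K - inner ℝ v` is nonnegative and vanishes at `x`, so its
derivative there is zero. -/
lemma gradient_eq_inv_supportFunction_smul (h0 : (0 : E n) ∈ interior (K : Set (E n))) {x : E n}
    (h1 : gauge (K : Set (E n)) x = 1) (hd : DifferentiableAt ℝ (gauge (K : Set (E n))) x)
    {v : UnitSphere n} (hv : inner ℝ x (v : E n) = supportFunction K (v : E n)) :
    gradient (gauge (K : Set (E n))) x = (supportFunction K (v : E n))⁻¹ • (v : E n) := by
  have hpos := supportFunction_pos h0 (coe_sphere_ne_zero v)
  set h := supportFunction K (v : E n) with hh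
  have hmin : IsLocalMin (fun y => h * gauge (K : Set (E n)) y - inner ℝ (v : E n) y) x := by
    refine Eventually.of_forall fun y => ?_
    simp only
    rw [h1, real_inner_comm, hv, mul_one, sub_self, sub_nonneg, real_inner_comm]
    exact inner_le_supportFunction_mul_gauge h0 y v
  have hderiv := hmin.fderiv_eq_zero
  have hdi : DifferentiableAt ℝ (fun y : E n => (inner ℝ (v : E n) y : ℝ)) x :=
    (innerSL ℝ (v : E n)).differentiableAt
  rw [fderiv_fun_sub (hd.const_mul h) hdi, fderiv_const_mul hd] at hderiv
  refine ext_inner_right ℝ fun z => ?_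
  have := congrArg (fun L : E n →L[ℝ] ℝ => L z) hderiv
  have hfd : fderiv ℝ (fun y : E n => (inner ℝ (v : E n) y : ℝ)) x = innerSL ℝ (v : E n) :=
    (innerSL ℝ (v : E n)).fderiv
  rw [hfd] at this
  simp only [sub_apply, smul_apply, innerSL_apply_apply, zero_apply,
    smul_eq_mul] at this
  rw [inner_gradient, inner_smul_left, RCLike.conj_to_real, eq_inv_mul_iff_mul_eq₀ hpos.ne']
  linarith

/-- For `y ∈ K`, the derivative of the gauge at `x` applied to `y` is at most the gauge of `y`,
hence at most 1, its value at `x` itself. -/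
lemma inner_unitNormal (h0 : (0 : E n) ∈ interior (K : Set (E n))) {x : E n}
    (h1 : gauge (K : Set (E n)) x = 1) (hd : DifferentiableAt ℝ (gauge (K : Set (E n))) x)
    (v₀ : UnitSphere n) :
    inner ℝ x (unitNormal v₀ (gauge (K : Set (E n))) x : E n) =
      supportFunction K (unitNormal v₀ (gauge (K : Set (E n))) x : E n) := by
  have hg := isConvexGauge_gauge h0
  have hne := norm_pos_iff.2 (hg.gradient_ne_zero h1 hd)
  have hxK : x ∈ K := (gauge_le_one_iff_mem h0).1 h1.le
  refine le_antisymm (inner_le_supportFunction hxK _) (supportFunction_le fun y hy => ?_)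
  have e : ∀ z : E n, ‖gradient (gauge (K : Set (E n))) x‖ *
      inner ℝ z (unitNormal v₀ (gauge (K : Set (E n))) x : E n) =
      fderiv ℝ (gauge (K : Set (E n))) x z := fun z => by
    rw [← inner_gradient, gradient_eq_smul_unitNormal v₀ (gauge (K : Set (E n))) x, inner_smul_left,
      ← gradient_eq_smul_unitNormal, real_inner_comm]
    rfl
  rw [← mul_le_mul_iff_right₀ hne, e, e, hg.fderiv_self hd, h1]
  exact (hg.fderiv_le hd y).trans ((gauge_le_one_iff_mem h0).2 hy)

lemma norm_gradient_mul_supportFunction (h0 : (0 : E n) ∈ interior (K : Set (E n))) {x : E n}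
    (h1 : gauge (K : Set (E n)) x = 1) (hd : DifferentiableAt ℝ (gauge (K : Set (E n))) x)
    (v₀ : UnitSphere n) :
    ‖gradient (gauge (K : Set (E n))) x‖ *
      supportFunction K (unitNormal v₀ (gauge (K : Set (E n))) x : E n) = 1 := by
  have hpos := supportFunction_pos h0 (coe_sphere_ne_zero (unitNormal v₀ (gauge (K : Set (E n))) x))
  rw [gradient_eq_inv_supportFunction_smul h0 h1 hd (inner_unitNormal h0 h1 hd v₀), norm_smul,
    norm_coe_sphere, mul_one, norm_inv, Real.norm_of_nonneg hpos.le, inv_mul_cancel₀ hpos.ne']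

lemma eq_unitNormal (h0 : (0 : E n) ∈ interior (K : Set (E n))) {x : E n}
    (h1 : gauge (K : Set (E n)) x = 1) (hd : DifferentiableAt ℝ (gauge (K : Set (E n))) x)
    (v₀ : UnitSphere n) {v : UnitSphere n}
    (hv : inner ℝ x (v : E n) = supportFunction K (v : E n)) :
    v = unitNormal v₀ (gauge (K : Set (E n))) x := by
  have hpos := supportFunction_pos h0 (coe_sphere_ne_zero v)
  have hgr := gradient_eq_inv_supportFunction_smul h0 h1 hd hv
  have hne := (isConvexGauge_gauge h0).gradient_ne_zero h1 hd
  ext1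
  simp only [unitNormal, if_neg hne]
  rw [hgr, norm_smul, norm_coe_sphere, mul_one, norm_inv, Real.norm_of_nonneg hpos.le, inv_inv,
    smul_inv_smul₀ hpos.ne']

/-! ### The Gaussian surface area measure -/

lemma measurable_gaussianDensity : Measurable (gaussianDensity n) := by
  unfold gaussianDensity
  fun_prop

/-- The Gaussian surface area as a pushforward of a weighted cone measure. -/
def gaussianSurfaceMeasure (v₀ : UnitSphere n) (g : E n → ℝ) : Measure (UnitSphere n) :=
  ((coneMeasure g).withDensity fun x => gaussianDensity n x * ‖gradient g x‖ₑ).map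
    (unitNormal v₀ g)

lemma lintegral_gaussianSurfaceMeasure (v₀ : UnitSphere n) (g : E n → ℝ) {f : UnitSphere n → ℝ≥0∞}
    (hf : Measurable f) :
    ∫⁻ v, f v ∂gaussianSurfaceMeasure v₀ g =
      ∫⁻ x, gaussianDensity n x * ‖gradient g x‖ₑ * f (unitNormal v₀ g x) ∂coneMeasure g := by
  have hm : Measurable fun x => gaussianDensity n x * ‖gradient g x‖ₑ :=
    measurable_gaussianDensity.mul (measurable_gradient g).enorm
  have hfν : Measurable fun x => f (unitNormal v₀ g x) := hf.comp (measurable_unitNormal v₀ g)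
  rw [gaussianSurfaceMeasure, lintegral_map hf (measurable_unitNormal v₀ g),
    lintegral_withDensity_eq_lintegral_mul _ hm hfν]
  rfl

/-- Off the negligible singular set the outer normal is unique and given by the gradient, so the
inverse Gauss image is a preimage under `unitNormal` up to a null set. In particular the set
function is a measure. -/
theorem gaussianSurfaceArea_eq (hn : 1 ≤ n) (h0 : (0 : E n) ∈ interior (K : Set (E n)))
    (v₀ : UnitSphere n) {η : Set (UnitSphere n)} (hη : MeasurableSet η) :
    gaussianSurfaceArea K η = gaussianSurfaceMeasure v₀ (gauge (K : Set (E n))) η := by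
  have hg := isConvexGauge_gauge h0
  set g := gauge (K : Set (E n)) with hgdef
  have hgm : Measurable g := hg.continuous.measurable
  have hS : MeasurableSet {x | g x = 1} := measurableSet_eq_fun hgm measurable_const
  have hν := measurable_unitNormal v₀ g
  have hae : inverseGaussImage K η =ᵐ[(μHE[n - 1] : Measure (E n))]
      (unitNormal v₀ g ⁻¹' η ∩ {x | g x = 1} : Set (E n)) := by
    have hnull := hg.euclideanHausdorffMeasure_singular hn
    have hnull' : ∀ᵐ x ∂(μHE[n - 1] : Measure (E n)), ¬ (g x = 1 ∧ ¬ DifferentiableAt ℝ g x) := by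
      rw [ae_iff]; simpa using hnull
    filter_upwards [hnull'] with x hx
    refine propext ?_
    change (∃ v ∈ η, IsOuterUnitNormal K x v) ↔ (unitNormal v₀ g x ∈ η ∧ g x = 1)
    constructor
    · rintro ⟨v, hv, hxf, hxv⟩
      have h1 : g x = 1 := (gauge_eq_one_iff h0).2 hxf
      have hd : DifferentiableAt ℝ g x := by
        by_contra hd
        exact hx ⟨h1, hd⟩
      rw [← eq_unitNormal h0 h1 hd v₀ hxv]
      exact ⟨hv, h1⟩
    · rintro ⟨hv, h1⟩
      have hd : DifferentiableAt ℝ g x := by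
        by_contra hd
        exact hx ⟨h1, hd⟩
      exact ⟨_, hv, (gauge_eq_one_iff h0).1 h1, inner_unitNormal h0 h1 hd v₀⟩
  rw [gaussianSurfaceArea, Measure.restrict_congr_set hae, ← Measure.restrict_restrict (hν hη),
    hg.restrict_euclideanHausdorffMeasure hn, gaussianSurfaceMeasure, Measure.map_apply hν hη,
    withDensity_apply _ (hν hη), setLIntegral_withDensity_eq_setLIntegral_mul _
      (measurable_gradient g).enorm measurable_gaussianDensity (hν hη)]
  simp only [Pi.mul_apply, mul_comm]

lemma gaussianDensity_neg (x : E n) : gaussianDensity n (-x) = gaussianDensity n x := by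
  simp [gaussianDensity]

lemma supportFunction_neg (hsymm : ∀ x ∈ K, -x ∈ K) (y : E n) :
    supportFunction K (-y) = supportFunction K y := by
  have : ∀ y, supportFunction K (-y) ≤ supportFunction K y := fun y =>
    supportFunction_le fun x hx => by
      have := inner_le_supportFunction (hsymm x hx) y
      rwa [inner_neg_left, ← inner_neg_right] at this
  exact le_antisymm (this y) (by simpa using this (-y))

lemma gaussianSurfaceArea_neg (hsymm : ∀ x ∈ K, -x ∈ K) (η : Set (UnitSphere n)) :
    gaussianSurfaceArea K ((fun v => -v) ⁻¹' η) = gaussianSurfaceArea K η := by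
  have hneg : (-(K : Set (E n))) = K := by
    ext y
    exact ⟨fun h => by simpa using hsymm _ h, fun h => hsymm _ h⟩
  have hfr : ∀ x, x ∈ frontier (K : Set (E n)) → -x ∈ frontier (K : Set (E n)) := by
    intro x hx
    have := (Homeomorph.neg (E n)).preimage_frontier (K : Set (E n))
    simp only [Homeomorph.coe_neg, neg_preimage, hneg] at this
    rw [← this] at hx
    exact hx
  have himg : inverseGaussImage K ((fun v => -v) ⁻¹' η) =
      (fun x : E n => -x) ⁻¹' inverseGaussImage K η := by
    ext x
    simp only [inverseGaussImage, IsOuterUnitNormal, mem_ofPred_eq, mem_preimage]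
    constructor
    · rintro ⟨v, hv, h1, h2⟩
      refine ⟨-v, hv, hfr x h1, ?_⟩
      rw [coe_neg_sphere, inner_neg_neg, supportFunction_neg hsymm, h2]
    · rintro ⟨v, hv, h1, h2⟩
      refine ⟨-v, by simpa using hv, by simpa using hfr _ h1, ?_⟩
      rw [coe_neg_sphere, supportFunction_neg hsymm, ← h2, inner_neg_left, inner_neg_right]
  have hmp := (IsometryEquiv.neg (E n)).measurePreserving_euclideanHausdorffMeasure (n - 1)
  rw [gaussianSurfaceArea, gaussianSurfaceArea, himg]
  have := hmp.setLIntegral_comp_preimage_emb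
    (IsometryEquiv.neg (E n)).toHomeomorph.measurableEmbedding (gaussianDensity n)
    (inverseGaussImage K η)
  rw [← this]
  simp only [IsometryEquiv.neg_apply, gaussianDensity_neg]
  rfl

end Normals

/-! ### First variation of the Gaussian volume -/

section Variation

variable {n : ℕ} {K : ConvexBody (E n)}

lemma continuous_gaussianDensity : Continuous (gaussianDensity n) := by
  unfold gaussianDensity
  exact ENNReal.continuous_ofReal.comp (by fun_prop)

lemma gaussianDensity_ne_top (x : E n) : gaussianDensity n x ≠ ∞ := ENNReal.ofReal_ne_top

lemma gaussianDensity_smul_le {R s r : ℝ} {x : E n} (hx : ‖x‖ ≤ R) (hs0 : 0 ≤ s) (hs : s < 1)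
    (hr : 1 - s ≤ r) :
    gaussianDensity n (r • x) ≤ ENNReal.ofReal (Real.exp (s * R ^ 2)) * gaussianDensity n x := by
  rw [gaussianDensity, gaussianDensity, ← ENNReal.ofReal_mul (Real.exp_pos _).le]
  refine ENNReal.ofReal_le_ofReal ?_
  rw [mul_left_comm, ← Real.exp_add]
  gcongr
  rw [norm_smul, mul_pow, Real.norm_eq_abs, sq_abs]
  have h1 : ‖x‖ ^ 2 ≤ R ^ 2 := by gcongr
  have h2 : (1 - s) ^ 2 ≤ r ^ 2 := by gcongr
  have h3 : (1 - 2 * s) * ‖x‖ ^ 2 ≤ r ^ 2 * ‖x‖ ^ 2 := by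
    gcongr
    nlinarith
  have h4 : s * ‖x‖ ^ 2 ≤ s * R ^ 2 := by gcongr
  linarith

lemma gaussianDensity_le_smul {s r : ℝ} {x : E n} (hs : 0 ≤ r) (hr : r ≤ s) :
    gaussianDensity n (s • x) ≤ gaussianDensity n (r • x) := by
  rw [gaussianDensity, gaussianDensity]
  refine ENNReal.ofReal_le_ofReal ?_
  gcongr
  rw [norm_smul, norm_smul, Real.norm_of_nonneg hs, Real.norm_of_nonneg (hs.trans hr)]
  gcongr

lemma gaussianMeasure_eq_coneMeasure {g : E n → ℝ} (hg : IsConvexGauge g) (hn : 1 ≤ n)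
    {A : Set (E n)} (hA : MeasurableSet A) :
    gaussianMeasure n A = ∫⁻ x, (∫⁻ s in Ioi (0 : ℝ),
      A.indicator (gaussianDensity n) (s • x) * ENNReal.ofReal (s ^ (n - 1))) ∂coneMeasure g := by
  rw [gaussianMeasure, withDensity_apply _ hA, ← lintegral_indicator hA,
    hg.lintegral_eq_lintegral_coneMeasure hn (measurable_gaussianDensity.indicator hA)]

/-! ### Dilations -/

/-- The ray through a regular boundary point `x` meets the shell for parameters in `(1 - s, 1]`, of
length `s`; there the density exceeds its value at `x` by at most the exponential factor and the
Jacobian is at most 1. -/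
lemma gaussianMeasure_diff_smul_le (hn : 1 ≤ n) (h0 : (0 : E n) ∈ interior (K : Set (E n)))
    {R s : ℝ} (hR : ∀ x ∈ K, ‖x‖ ≤ R) (hs0 : 0 < s) (hs1 : s < 1) :
    gaussianMeasure n ((K : Set (E n)) \ ((1 - s) • (K : Set (E n)))) ≤
      ENNReal.ofReal (s * Real.exp (s * R ^ 2)) *
        ∫⁻ x, gaussianDensity n x ∂coneMeasure (gauge (K : Set (E n))) := by
  have hg := isConvexGauge_gauge h0
  have h1s : 0 < 1 - s := by linarith
  have hm : MeasurableSet ((K : Set (E n)) \ ((1 - s) • (K : Set (E n)))) :=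
    K.isClosed.measurableSet.diff (K.isClosed.measurableSet.const_smul₀ _)
  rw [gaussianMeasure_eq_coneMeasure hg hn hm, ← lintegral_const_mul _ measurable_gaussianDensity]
  refine lintegral_mono_ae ?_
  filter_upwards [hg.coneMeasure_ae] with x hx
  have hxK : x ∈ K := (gauge_le_one_iff_mem h0).1 hx.1.le
  have hbound : ∀ r ∈ Ioi (0 : ℝ),
      ((K : Set (E n)) \ ((1 - s) • (K : Set (E n)))).indicator (gaussianDensity n) (r • x) *
        ENNReal.ofReal (r ^ (n - 1)) ≤
      (Ioc (1 - s) 1).indicator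
        (fun _ => ENNReal.ofReal (Real.exp (s * R ^ 2)) * gaussianDensity n x) r := by
    intro r (hr : 0 < r)
    by_cases hmem : r • x ∈ (K : Set (E n)) \ ((1 - s) • (K : Set (E n)))
    · have hr1 : r ≤ 1 := by
        have := (gauge_le_one_iff_mem h0).2 hmem.1
        rwa [hg.smul _ _ hr.le, hx.1, mul_one] at this
      have hrs : 1 - s < r := by
        by_contra hle
        refine hmem.2 ?_
        rw [mem_smul_set_iff_inv_smul_mem₀ h1s.ne', smul_smul, SetLike.mem_coe,
          ← gauge_le_one_iff_mem h0, hg.smul _ _ (by positivity), hx.1, mul_one,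
          inv_mul_le_iff₀ h1s, mul_one]
        exact not_lt.1 hle
      rw [indicator_of_mem hmem, indicator_of_mem (show r ∈ Ioc (1 - s) 1 from ⟨hrs, hr1⟩)]
      calc _ ≤ (ENNReal.ofReal (Real.exp (s * R ^ 2)) * gaussianDensity n x) * 1 := by
            gcongr
            · exact gaussianDensity_smul_le (hR x hxK) hs0.le hs1 hrs.le
            · rw [ENNReal.ofReal_le_one]
              exact pow_le_one₀ hr.le hr1
        _ = _ := mul_one _
    · rw [indicator_of_notMem hmem, zero_mul]
      exact zero_le
  calc _ ≤ ∫⁻ r in Ioi (0 : ℝ), (Ioc (1 - s) 1).indicator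
        (fun _ => ENNReal.ofReal (Real.exp (s * R ^ 2)) * gaussianDensity n x) r :=
        setLIntegral_mono' measurableSet_Ioi hbound
    _ ≤ ∫⁻ r, (Ioc (1 - s) 1).indicator
        (fun _ => ENNReal.ofReal (Real.exp (s * R ^ 2)) * gaussianDensity n x) r :=
        setLIntegral_le_lintegral _ _
    _ = _ := by
      rw [lintegral_indicator_const measurableSet_Ioc, Real.volume_Ioc, sub_sub_cancel,
        ENNReal.ofReal_mul hs0.le]
      ring

/-- The support function at the normal is the reciprocal of `‖∇g‖`, so it cancels the surface
density. -/
lemma lintegral_supportFunction_gaussianSurfaceMeasure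
    (h0 : (0 : E n) ∈ interior (K : Set (E n))) (v₀ : UnitSphere n) :
    ∫⁻ v, ENNReal.ofReal (supportFunction K (v : E n))
        ∂gaussianSurfaceMeasure v₀ (gauge (K : Set (E n))) =
      ∫⁻ x, gaussianDensity n x ∂coneMeasure (gauge (K : Set (E n))) := by
  have hm : Measurable fun v : UnitSphere n => ENNReal.ofReal (supportFunction K (v : E n)) :=
    ((continuous_supportFunction K).measurable.comp measurable_subtype_coe).ennreal_ofReal
  rw [lintegral_gaussianSurfaceMeasure _ _ hm]
  refine lintegral_congr_ae ?_
  filter_upwards [(isConvexGauge_gauge h0).coneMeasure_ae] with x hx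
  rw [mul_assoc, ← ofReal_norm, ← ENNReal.ofReal_mul (norm_nonneg _),
    norm_gradient_mul_supportFunction h0 hx.1 hx.2 v₀, ENNReal.ofReal_one, mul_one]

lemma lintegral_gaussianDensity_coneMeasure_lt_top
    (h0 : (0 : E n) ∈ interior (K : Set (E n))) :
    ∫⁻ x, gaussianDensity n x ∂coneMeasure (gauge (K : Set (E n))) < ∞ := by
  have hg := isConvexGauge_gauge h0
  have hfin : coneMeasure (gauge (K : Set (E n))) univ < ∞ := by
    rw [coneMeasure_apply hg.continuous.measurable MeasurableSet.univ]
    refine ENNReal.mul_lt_top (by simp) ?_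
    refine (measure_mono (t := (K : Set (E n))) ?_).trans_lt K.isCompact.measure_lt_top
    rintro x ⟨-, hx, -⟩
    exact (gauge_le_one_iff_mem h0).1 hx
  have hb : ∀ x : E n, gaussianDensity n x ≤ gaussianDensity n 0 := fun x => by
    simpa using gaussianDensity_le_smul (x := x) le_rfl zero_le_one
  calc _ ≤ ∫⁻ _, gaussianDensity n 0 ∂coneMeasure (gauge (K : Set (E n))) := lintegral_mono hb
    _ < ∞ := by
      rw [lintegral_const]
      exact ENNReal.mul_lt_top (gaussianDensity_ne_top 0).lt_top hfin

/-! ### Wulff shapes -/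

/-- The Wulff shape of a nonnegative continuous function on the sphere. -/
def wulffShape (hn : 1 ≤ n) (u : UnitSphere n → ℝ) (hu : Continuous u) (hu0 : ∀ v, 0 ≤ u v) :
    ConvexBody (E n) where
  carrier := {x | ∀ v : UnitSphere n, inner ℝ x (v : E n) ≤ u v}
  convex' := by
    rw [ofPred_forall]
    refine convex_iInter fun v => ?_
    have : IsLinearMap ℝ fun x : E n => (inner ℝ x (v : E n) : ℝ) :=
      ⟨fun x y => inner_add_left _ _ _, fun c x => by simp [inner_smul_left]⟩
    exact convex_halfSpace_le this _
  isCompact' := by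
    have := nontrivial_E hn
    refine isCompact_of_isClosed_isBounded ?_ ?_
    · rw [ofPred_forall]
      exact isClosed_iInter fun v => isClosed_le (by fun_prop) continuous_const
    · obtain ⟨M, hM⟩ := (isCompact_range hu).bddAbove
      refine (isBounded_closedBall (x := (0 : E n)) (r := M)).subset fun x hx => ?_
      rw [mem_closedBall_zero_iff]
      rcases eq_or_ne x 0 with rfl | hx0
      · obtain ⟨v⟩ : Nonempty (UnitSphere n) := (NormedSpace.sphere_nonempty.2 zero_le_one).to_subtype
        rw [norm_zero]
        exact (hu0 v).trans (hM ⟨v, rfl⟩)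
      · have hxn : ‖x‖ ≠ 0 := norm_ne_zero_iff.2 hx0
        have := hx ⟨‖x‖⁻¹ • x, by
          rw [mem_sphere_zero_iff_norm, norm_smul, norm_inv, norm_norm, inv_mul_cancel₀ hxn]⟩
        simp only [inner_smul_right, real_inner_self_eq_norm_sq] at this
        have e : ‖x‖⁻¹ * ‖x‖ ^ 2 = ‖x‖ := by field_simp
        rw [e] at this
        exact this.trans (hM ⟨_, rfl⟩)
  nonempty' := ⟨0, fun v => by simpa using hu0 v⟩

/-- At a regular boundary point, perturbing the support function by `t f` pushes the boundary out
at speed at least `f ‖∇ g‖` in the radial direction. -/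
lemma eventually_smul_mem_perturbed (h0 : (0 : E n) ∈ interior (K : Set (E n))) {x : E n}
    (h1 : gauge (K : Set (E n)) x = 1) (hd : DifferentiableAt ℝ (gauge (K : Set (E n))) x)
    (v₀ : UnitSphere n) {f : UnitSphere n → ℝ} (hf : Continuous f) (hf0 : ∀ v, 0 ≤ f v)
    {a : ℝ} (ha : 0 < a)
    (haf : a < f (unitNormal v₀ (gauge (K : Set (E n))) x) * ‖gradient (gauge (K : Set (E n))) x‖) :
    ∀ᶠ t in 𝓝[>] (0 : ℝ), ∀ s ∈ Icc 1 (1 + t * a), ∀ v : UnitSphere n,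
      inner ℝ (s • x) (v : E n) ≤ supportFunction K (v : E n) + t * f v := by
  have hxK : x ∈ K := (gauge_le_one_iff_mem h0).1 h1.le
  -- Outside `B` the perturbation `t * f v` absorbs the displacement of `x`. On `B` the constraint
  -- at `x` is strict: equality would make `v` the normal at `x`, contradicting `haf`. Compactness
  -- gives uniform slack `δ`, enough for small `t`.
  set B : Set (UnitSphere n) := {v | f v ≤ a * inner ℝ x (v : E n)} with hB
  have hBc : IsCompact B := (isClosed_le hf (by fun_prop)).isCompact
  obtain ⟨δ, hδ, hBδ⟩ : ∃ δ > 0, ∀ v ∈ B, inner ℝ x (v : E n) + δ ≤ supportFunction K (v : E n) := by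
    rcases B.eq_empty_or_nonempty with hBe | hBne
    · exact ⟨1, one_pos, by simp [hBe]⟩
    have hcont : Continuous fun v : UnitSphere n =>
        supportFunction K (v : E n) - inner ℝ x (v : E n) :=
      ((continuous_supportFunction K).comp continuous_subtype_val).sub (by fun_prop)
    obtain ⟨w, hw, hmin⟩ := hBc.exists_isMinOn hBne hcont.continuousOn
    refine ⟨supportFunction K (w : E n) - inner ℝ x (w : E n), ?_, fun v hv => ?_⟩
    · refine lt_of_le_of_ne (sub_nonneg.2 (inner_le_supportFunction hxK _)) fun h => ?_
      have heq : inner ℝ x (w : E n) = supportFunction K (w : E n) := by linarith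
      have hwν := eq_unitNormal h0 h1 hd v₀ heq
      have h2 := norm_gradient_mul_supportFunction h0 h1 hd v₀
      rw [← hwν] at h2 haf
      have hwB : f w ≤ a * inner ℝ x (w : E n) := hw
      rw [heq] at hwB
      have h3 : f w * ‖gradient (gauge (K : Set (E n))) x‖ ≤
          (a * supportFunction K (w : E n)) * ‖gradient (gauge (K : Set (E n))) x‖ := by gcongr
      nlinarith
    · have : supportFunction K (w : E n) - inner ℝ x (w : E n) ≤
          supportFunction K (v : E n) - inner ℝ x (v : E n) := hmin hv
      linarith
  have hpos : 0 < δ / (a * ‖x‖ + 1) := by positivity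
  filter_upwards [Ioo_mem_nhdsGT hpos] with t ht s hs v
  have ht0 := ht.1
  have hxv := inner_le_supportFunction hxK (v : E n)
  have hhv := supportFunction_pos h0 (coe_sphere_ne_zero v)
  have hfv := hf0 v
  rw [inner_smul_left, RCLike.conj_to_real]
  have htf : 0 ≤ t * f v := by positivity
  rcases le_or_gt (inner ℝ x (v : E n)) 0 with hneg | hposi
  · nlinarith [hs.1]
  have hle : s * inner ℝ x (v : E n) ≤ (1 + t * a) * inner ℝ x (v : E n) := by
    gcongr; exact hs.2
  refine hle.trans ?_
  by_cases hvB : v ∈ B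
  · have h4 := hBδ v hvB
    have h5 : inner ℝ x (v : E n) ≤ ‖x‖ := by
      simpa [norm_coe_sphere] using real_inner_le_norm x (v : E n)
    have h6 : t * (a * ‖x‖ + 1) < δ := (lt_div_iff₀ (by positivity)).1 ht.2
    have h7 : t * a * inner ℝ x (v : E n) ≤ t * a * ‖x‖ := by gcongr
    nlinarith
  · have h4 : a * inner ℝ x (v : E n) < f v := not_le.1 hvB
    have h5 : t * (a * inner ℝ x (v : E n)) ≤ t * f v := by gcongr
    nlinarith

/-- Lower bound for the first variation of the Gaussian volume. -/
theorem lintegral_gaussianSurfaceMeasure_le_liminf (hn : 1 ≤ n)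
    (h0 : (0 : E n) ∈ interior (K : Set (E n))) (v₀ : UnitSphere n) {f : UnitSphere n → ℝ}
    (hf : Continuous f) (hf0 : ∀ v, 0 ≤ f v) {t : ℕ → ℝ} (ht : ∀ k, 0 < t k)
    (ht0 : Tendsto t atTop (𝓝 0)) {L : ℕ → Set (E n)} (hLm : ∀ k, MeasurableSet (L k))
    (hL : ∀ k x, (∀ v : UnitSphere n,
      inner ℝ x (v : E n) ≤ supportFunction K (v : E n) + t k * f v) → x ∈ L k) :
    ∫⁻ v, ENNReal.ofReal (f v) ∂gaussianSurfaceMeasure v₀ (gauge (K : Set (E n))) ≤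
      liminf (fun k => ENNReal.ofReal (t k)⁻¹ * gaussianMeasure n (L k \ K)) atTop := by
  have hg := isConvexGauge_gauge h0
  set g := gauge (K : Set (E n)) with hgdef
  have htw : Tendsto t atTop (𝓝[>] 0) :=
    tendsto_nhdsWithin_iff.2 ⟨ht0, Eventually.of_forall ht⟩
  have hdm : ∀ k, MeasurableSet (L k \ K) := fun k => (hLm k).diff K.isClosed.measurableSet
  set I : ℕ → E n → ℝ≥0∞ := fun k x => ENNReal.ofReal (t k)⁻¹ * ∫⁻ s in Ioi (0 : ℝ),
    (L k \ K).indicator (gaussianDensity n) (s • x) * ENNReal.ofReal (s ^ (n - 1)) with hI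
  have hIm : ∀ k, Measurable (I k) := by
    intro k
    refine Measurable.const_mul (Measurable.lintegral_prod_right' (f := fun q : E n × ℝ =>
      (L k \ K).indicator (gaussianDensity n) (q.2 • q.1) * ENNReal.ofReal (q.2 ^ (n - 1))) ?_) _
    exact ((measurable_gaussianDensity.indicator (hdm k)).comp (by fun_prop)).mul (by fun_prop)
  have hIint : ∀ k, ENNReal.ofReal (t k)⁻¹ * gaussianMeasure n (L k \ K) =
      ∫⁻ x, I k x ∂coneMeasure g := fun k => by
    rw [gaussianMeasure_eq_coneMeasure hg hn (hdm k), hI,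
      lintegral_const_mul' _ _ ENNReal.ofReal_ne_top]
  simp_rw [hIint]
  rw [lintegral_gaussianSurfaceMeasure v₀ g hf.measurable.ennreal_ofReal]
  -- Fatou reduces the claim to a bound along the ray through almost every boundary point.
  refine le_trans (lintegral_mono_ae ?_) (lintegral_liminf_le hIm)
  filter_upwards [hg.coneMeasure_ae] with x hx
  set b := f (unitNormal v₀ g x) * ‖gradient g x‖ with hb
  have hb0 : 0 ≤ b := mul_nonneg (hf0 _) (norm_nonneg _)
  have hlhs : gaussianDensity n x * ‖gradient g x‖ₑ * ENNReal.ofReal (f (unitNormal v₀ g x)) =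
      ENNReal.ofReal b * gaussianDensity n x := by
    rw [hb, ENNReal.ofReal_mul (hf0 _), ofReal_norm]; ring
  rw [hlhs]
  have hmain : ∀ a, 0 < a → a < b →
      ENNReal.ofReal a * gaussianDensity n x ≤ liminf (fun k => I k x) atTop := by
    intro a ha hab
    have hlim : Tendsto (fun k => ENNReal.ofReal a * gaussianDensity n ((1 + t k * a) • x)) atTop
        (𝓝 (ENNReal.ofReal a * gaussianDensity n x)) := by
      refine ENNReal.Tendsto.const_mul ?_ (Or.inr ENNReal.ofReal_ne_top)
      have h1 : Tendsto (fun k => (1 + t k * a) • x) atTop (𝓝 x) := by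
        have : Tendsto (fun k => (1 + t k * a) • x) atTop (𝓝 ((1 + 0 * a) • x)) :=
          ((ht0.mul_const a).const_add 1).smul_const x
        simpa using this
      exact (continuous_gaussianDensity.tendsto x).comp h1
    rw [← hlim.liminf_eq]
    refine liminf_le_liminf ?_
    filter_upwards [htw.eventually (eventually_smul_mem_perturbed h0 hx.1 hx.2 v₀ hf hf0 ha hab)]
      with k hk
    have htk := ht k
    have hta : 0 < t k * a := mul_pos htk ha
    -- This part of the ray lies in `L k \ K`; the density there is least at the outer end, and `s ^
    -- (n - 1)` is at least 1.
    have hle : ∫⁻ s in Ioc 1 (1 + t k * a), gaussianDensity n ((1 + t k * a) • x) ≤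
        ∫⁻ s in Ioi (0 : ℝ), (L k \ K).indicator (gaussianDensity n) (s • x) *
          ENNReal.ofReal (s ^ (n - 1)) := by
      refine le_trans (setLIntegral_mono' measurableSet_Ioc fun s hs => ?_)
        (lintegral_mono_set (s := Ioc 1 (1 + t k * a)) fun s hs => zero_lt_one.trans hs.1)
      have hmem : s • x ∈ L k \ K := by
        refine ⟨hL k _ (hk s ⟨hs.1.le, hs.2⟩), fun h => ?_⟩
        have := (gauge_le_one_iff_mem h0).2 h
        rw [← hgdef, hg.smul _ _ (zero_le_one.trans hs.1.le), hx.1, mul_one] at this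
        exact absurd hs.1 (not_lt.2 this)
      rw [indicator_of_mem hmem]
      calc _ ≤ gaussianDensity n (s • x) * 1 := by
            rw [mul_one]
            exact gaussianDensity_le_smul (zero_le_one.trans hs.1.le) hs.2
        _ ≤ _ := by
            gcongr
            rw [ENNReal.one_le_ofReal]
            exact one_le_pow₀ hs.1.le
    rw [setLIntegral_const, Real.volume_Ioc, add_sub_cancel_left] at hle
    calc ENNReal.ofReal a * gaussianDensity n ((1 + t k * a) • x)
        = ENNReal.ofReal (t k)⁻¹ *
          (gaussianDensity n ((1 + t k * a) • x) * ENNReal.ofReal (t k * a)) := by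
          rw [mul_left_comm, ← ENNReal.ofReal_mul (inv_pos.2 htk).le,
            inv_mul_cancel_left₀ htk.ne', mul_comm]
      _ ≤ _ := mul_le_mul_right hle _
  rcases hb0.eq_or_lt with hb0 | hbpos
  · rw [← hb0, ENNReal.ofReal_zero, zero_mul]
    exact zero_le
  have hlim : Tendsto (fun a : ℝ => ENNReal.ofReal a * gaussianDensity n x) (𝓝[<] b)
      (𝓝 (ENNReal.ofReal b * gaussianDensity n x)) := by
    refine ENNReal.Tendsto.mul_const ?_ (Or.inr (gaussianDensity_ne_top x))
    exact (ENNReal.continuous_ofReal.tendsto b).mono_left nhdsWithin_le_nhds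
  refine le_of_tendsto hlim ?_
  filter_upwards [Ioo_mem_nhdsLT hbpos] with a ha using hmain a ha.1 ha.2

end Variation

/-! ### Compactness, semicontinuity and existence of a maximizer -/

section Existence

variable {n : ℕ} {K : ConvexBody (E n)}

/-! ### Compactness of families of convex bodies -/

/-- A convex body as a nonempty compact set. -/
def toNonemptyCompacts (K : ConvexBody (E n)) : TopologicalSpace.NonemptyCompacts (E n) :=
  ⟨⟨K, K.isCompact⟩, K.nonempty⟩

lemma isometry_toNonemptyCompacts : Isometry (toNonemptyCompacts (n := n)) :=
  Isometry.of_dist_eq fun _ _ => rfl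

lemma exists_dist_le_hausdorffDist {L M : TopologicalSpace.NonemptyCompacts (E n)} {x : E n}
    (hx : x ∈ L) : ∃ y ∈ M, dist x y ≤ dist L M := by
  obtain ⟨y, hy, hxy⟩ := M.isCompact.exists_infDist_eq_dist M.nonempty x
  refine ⟨y, hy, ?_⟩
  rw [← hxy, NonemptyCompacts.dist_eq]
  exact infDist_le_hausdorffDist_of_mem hx (edist_ne_top L M)

lemma exists_mem_dist_le (K L : ConvexBody (E n)) {x : E n} (hx : x ∈ K) :
    ∃ y ∈ L, dist x y ≤ dist K L :=
  exists_dist_le_hausdorffDist (L := toNonemptyCompacts K) (M := toNonemptyCompacts L) hx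

/-- Written through distance functions, convexity becomes a family of conditions that are closed in
the Hausdorff metric, since the distance from a fixed point is Lipschitz in the set. -/
lemma convex_iff_infDist (L : TopologicalSpace.NonemptyCompacts (E n)) :
    Convex ℝ (L : Set (E n)) ↔ ∀ x y : E n, ∀ a b : ℝ, 0 ≤ a → 0 ≤ b → a + b = 1 →
      infDist (a • x + b • y) L ≤ a * infDist x L + b * infDist y L := by
  constructor
  · intro h x y a b ha hb hab
    obtain ⟨x', hx', hxx'⟩ := L.isCompact.exists_infDist_eq_dist L.nonempty x
    obtain ⟨y', hy', hyy'⟩ := L.isCompact.exists_infDist_eq_dist L.nonempty y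
    refine (infDist_le_dist_of_mem (h hx' hy' ha hb hab)).trans ?_
    rw [hxx', hyy', dist_eq_norm, dist_eq_norm, dist_eq_norm]
    calc ‖a • x + b • y - (a • x' + b • y')‖ = ‖a • (x - x') + b • (y - y')‖ := by
          rw [smul_sub, smul_sub]; congr 1; abel
      _ ≤ ‖a • (x - x')‖ + ‖b • (y - y')‖ := norm_add_le _ _
      _ = _ := by rw [norm_smul, norm_smul, Real.norm_of_nonneg ha, Real.norm_of_nonneg hb]
  · intro h x hx y hy a b ha hb hab
    rw [L.isCompact.isClosed.mem_iff_infDist_zero L.nonempty]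
    refine le_antisymm ?_ infDist_nonneg
    have := h x y a b ha hb hab
    rwa [infDist_zero_of_mem hx, infDist_zero_of_mem hy, mul_zero, mul_zero, add_zero] at this

lemma isClosed_setOf_convex :
    IsClosed {L : TopologicalSpace.NonemptyCompacts (E n) | Convex ℝ (L : Set (E n))} := by
  simp only [convex_iff_infDist, ofPred_forall]
  refine isClosed_iInter fun x => isClosed_iInter fun y => isClosed_iInter fun a =>
    isClosed_iInter fun b => isClosed_iInter fun _ => isClosed_iInter fun _ =>
    isClosed_iInter fun _ => ?_
  have h := fun z : E n => (lipschitz_infDist_set z).continuous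
  exact isClosed_le (h _) (((h x).const_mul a).add ((h y).const_mul b))

lemma isClosed_setOf_symmetric :
    IsClosed {L : TopologicalSpace.NonemptyCompacts (E n) | ∀ x ∈ L, -x ∈ L} := by
  have heq : {L : TopologicalSpace.NonemptyCompacts (E n) | ∀ x ∈ L, -x ∈ L} =
      {L : TopologicalSpace.NonemptyCompacts (E n) |
        ∀ x : E n, infDist (-x) (L : Set (E n)) ≤ infDist x L} := by
    ext L
    constructor
    · intro h x
      obtain ⟨y, hy, hxy⟩ := L.isCompact.exists_infDist_eq_dist L.nonempty x
      rw [hxy, ← dist_neg_neg]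
      exact infDist_le_dist_of_mem (h y hy)
    · intro h x hx
      rw [← SetLike.mem_coe, L.isCompact.isClosed.mem_iff_infDist_zero L.nonempty]
      refine le_antisymm ((h x).trans ?_) infDist_nonneg
      rw [infDist_zero_of_mem hx]
  rw [heq, ofPred_forall]
  have h := fun z : E n => (lipschitz_infDist_set z).continuous
  exact isClosed_iInter fun x => isClosed_le (h _) (h _)

/-- **Blaschke selection theorem** for symmetric convex bodies in a ball. -/
theorem isCompact_symmetric_convexBodies (R : ℝ) :
    IsCompact {K : ConvexBody (E n) | (K : Set (E n)) ⊆ closedBall 0 R ∧ ∀ x ∈ K, -x ∈ K} := by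
  have hrange : range (toNonemptyCompacts (n := n)) =
      {L : TopologicalSpace.NonemptyCompacts (E n) | Convex ℝ (L : Set (E n))} := by
    ext L
    constructor
    · rintro ⟨K, rfl⟩
      exact K.convex
    · intro hL
      exact ⟨⟨L, hL, L.isCompact, L.nonempty⟩, rfl⟩
  have hemb : IsClosedEmbedding (toNonemptyCompacts (n := n)) :=
    ⟨isometry_toNonemptyCompacts.isEmbedding, by rw [hrange]; exact isClosed_setOf_convex⟩
  have := hemb.isCompact_preimage
    ((TopologicalSpace.NonemptyCompacts.isCompact_subsets_of_isCompact
      (isCompact_closedBall (0 : E n) R)).inter_right isClosed_setOf_symmetric)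
  exact this

/-! ### Semicontinuity -/

instance : IsFiniteMeasure (gaussianMeasure n) := by
  refine isFiniteMeasure_withDensity_ofReal (Integrable.hasFiniteIntegral ?_)
  refine Integrable.const_mul ?_ _
  have h := (GaussianFourier.integrable_cexp_neg_mul_sq_norm_add (V := E n) (b := (1 / 2 : ℂ))
    (by norm_num) 0 0).norm
  refine h.congr (Eventually.of_forall fun x => ?_)
  simp only [Complex.norm_exp]
  congr 1
  have : (-(1 / 2 : ℂ) * (‖x‖ : ℂ) ^ 2 + 0 * ((inner ℝ (0 : E n) x : ℝ) : ℂ)) =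
      ((-‖x‖ ^ 2 / 2 : ℝ) : ℂ) := by
    push_cast; ring
  rw [this, Complex.ofReal_re]

/-- Bodies near `K` lie in a closed thickening of `K`, whose measure tends to that of `K`. -/
lemma upperSemicontinuous_gaussianMeasure :
    UpperSemicontinuous fun K : ConvexBody (E n) => (gaussianMeasure n).real K := by
  intro K c hc
  have ht := tendsto_measure_cthickening_of_isCompact (μ := gaussianMeasure n) K.isCompact
  have ht' := (ENNReal.tendsto_toReal (measure_ne_top _ _)).comp ht
  have hev : ∀ᶠ δ in 𝓝[>] (0 : ℝ), (gaussianMeasure n).real (cthickening δ (K : Set (E n))) < c :=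
    (ht'.eventually (gt_mem_nhds hc)).filter_mono nhdsWithin_le_nhds
  obtain ⟨δ, hδc, hδ⟩ := (hev.and self_mem_nhdsWithin).exists
  filter_upwards [ball_mem_nhds K hδ] with L hL
  refine lt_of_le_of_lt (measureReal_mono ?_ (measure_ne_top _ _)) hδc
  intro x hx
  obtain ⟨y, hy, hxy⟩ := exists_mem_dist_le L K hx
  exact mem_cthickening_of_dist_le x y δ _ hy (hxy.trans (mem_ball.1 hL).le)

lemma supportFunction_le_add (K L : ConvexBody (E n)) (v : UnitSphere n) :
    supportFunction K (v : E n) ≤ supportFunction L (v : E n) + dist K L := by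
  refine supportFunction_le fun x hx => ?_
  obtain ⟨y, hy, hxy⟩ := exists_mem_dist_le K L hx
  have h1 := inner_le_supportFunction hy (v : E n)
  have h2 := real_inner_le_norm (x - y) (v : E n)
  rw [norm_coe_sphere, mul_one, ← dist_eq_norm, inner_sub_left] at h2
  linarith

lemma integrable_of_continuous_sphere (μ : Measure (UnitSphere n)) [IsFiniteMeasure μ]
    {f : UnitSphere n → ℝ} (hf : Continuous f) : Integrable f μ :=
  hf.integrable_of_hasCompactSupport (HasCompactSupport.of_compactSpace f)

lemma continuous_supportFunction_sphere (K : ConvexBody (E n)) :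
    Continuous fun v : UnitSphere n => supportFunction K (v : E n) :=
  (continuous_supportFunction K).comp continuous_subtype_val

lemma continuous_integral_supportFunction (μ : Measure (UnitSphere n)) [IsFiniteMeasure μ] :
    Continuous fun K : ConvexBody (E n) => ∫ v, supportFunction K (v : E n) ∂μ := by
  have hle : ∀ K L : ConvexBody (E n), ∫ v, supportFunction K (v : E n) ∂μ ≤
      ∫ v, supportFunction L (v : E n) ∂μ + μ.real univ * dist K L := by
    intro K L
    have hK := integrable_of_continuous_sphere μ (continuous_supportFunction_sphere K)
    have hL := integrable_of_continuous_sphere μ (continuous_supportFunction_sphere L)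
    calc _ ≤ ∫ v, (supportFunction L (v : E n) + dist K L) ∂μ :=
          integral_mono hK (hL.add (integrable_const _)) fun v => supportFunction_le_add K L v
      _ = _ := by
        rw [integral_add hL (integrable_const _), integral_const, smul_eq_mul]
  refine (LipschitzWith.of_dist_le_mul (K := (μ.real univ).toNNReal) fun K L => ?_).continuous
  rw [Real.coe_toNNReal _ measureReal_nonneg, Real.dist_eq, abs_sub_le_iff]
  have h1 := hle K L
  have h2 := hle L K
  rw [dist_comm] at h2
  constructor <;> linarith

/-! ### The variational problem -/

/-- The functional whose maximizers solve the Minkowski problem. -/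
def minkowskiFunctional (μ : Measure (UnitSphere n)) (α : ℝ) (K : ConvexBody (E n)) : ℝ :=
  (gaussianMeasure n).real K ^ α / α - ∫ v, supportFunction K (v : E n) ∂μ

lemma upperSemicontinuous_minkowskiFunctional (μ : Measure (UnitSphere n)) [IsFiniteMeasure μ]
    {α : ℝ} (hα : 0 < α) : UpperSemicontinuous (minkowskiFunctional μ α) := by
  -- Truncation at 0 makes the power monotone on all of `ℝ` and changes nothing on measures.
  have hc : Continuous fun t : ℝ => max t 0 ^ α / α :=
    ((continuous_id.max continuous_const).rpow_const fun _ => Or.inr hα.le).div_const α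
  have hm : Monotone fun t : ℝ => max t 0 ^ α / α := by
    intro s t hst
    change max s 0 ^ α / α ≤ max t 0 ^ α / α
    gcongr
  have h1 := hc.comp_upperSemicontinuous (upperSemicontinuous_gaussianMeasure (n := n)) hm
  have h2 := (continuous_integral_supportFunction μ).neg.upperSemicontinuous
  have h3 := h1.add h2
  have heq : minkowskiFunctional μ α = fun K => ((fun t : ℝ => max t 0 ^ α / α) ∘
      fun K : ConvexBody (E n) => (gaussianMeasure n).real K) K +
      (-fun K : ConvexBody (E n) => ∫ v, supportFunction K (v : E n) ∂μ) K := by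
    funext K
    rw [Function.comp_apply, max_eq_left measureReal_nonneg, minkowskiFunctional, sub_eq_add_neg]
    rfl
  rw [heq]
  exact h3

/-- By homogeneity the best constant is the minimum over unit vectors, attained at some `u`; if it
were zero, `μ` would live on the great subsphere orthogonal to `u`, inside a closed hemisphere. -/
lemma exists_pos_mul_norm_le_integral_abs_inner (hn : 1 ≤ n) (μ : Measure (UnitSphere n))
    [IsFiniteMeasure μ]
    (hμ : ∀ u : UnitSphere n, ¬ IsConcentratedIn μ (closedHemisphere u)) :
    ∃ c > 0, ∀ x : E n, c * ‖x‖ ≤ ∫ v : UnitSphere n, |inner ℝ x (v : E n)| ∂μ := by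
  have := nontrivial_E hn
  have hint : ∀ x : E n, Integrable (fun v : UnitSphere n => |inner ℝ x (v : E n)|) μ := fun x =>
    integrable_of_continuous_sphere μ (by fun_prop)
  have hcont : Continuous fun u : UnitSphere n =>
      ∫ v : UnitSphere n, |inner ℝ (u : E n) (v : E n)| ∂μ := by
    refine continuous_of_dominated (bound := fun _ => 1) (fun u => (hint u).aestronglyMeasurable)
      (fun u => Eventually.of_forall fun v => ?_) (integrable_const _)
      (Eventually.of_forall fun v => by fun_prop)
    rw [Real.norm_eq_abs, abs_abs]
    simpa [norm_coe_sphere] using abs_real_inner_le_norm (u : E n) (v : E n)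
  have : Nonempty (UnitSphere n) := (NormedSpace.sphere_nonempty.2 zero_le_one).to_subtype
  obtain ⟨u, -, hu⟩ := isCompact_univ.exists_isMinOn univ_nonempty hcont.continuousOn
  refine ⟨∫ v : UnitSphere n, |inner ℝ (u : E n) (v : E n)| ∂μ, ?_, fun x => ?_⟩
  · refine lt_of_le_of_ne (integral_nonneg fun v => abs_nonneg _) fun h => hμ u ?_
    have h0 := (integral_eq_zero_iff_of_nonneg (fun v => abs_nonneg _) (hint u)).1 h.symm
    rw [IsConcentratedIn]
    refine measure_mono_null (fun v hv => ?_) (ae_iff.1 h0)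
    have hv' : ¬ 0 ≤ inner ℝ (u : E n) (v : E n) := hv
    intro h
    simp only [Pi.zero_apply, abs_eq_zero] at h
    exact hv' h.ge
  · rcases eq_or_ne x 0 with rfl | hx
    · simp
    have hxn : ‖x‖ ≠ 0 := norm_ne_zero_iff.2 hx
    have hw : ‖x‖⁻¹ • x ∈ sphere (0 : E n) 1 := by
      rw [mem_sphere_zero_iff_norm, norm_smul, norm_inv, norm_norm, inv_mul_cancel₀ hxn]
    have h1 := hu (mem_univ (⟨‖x‖⁻¹ • x, hw⟩ : UnitSphere n))
    simp only [mem_ofPred_eq, inner_smul_left, RCLike.conj_to_real, abs_mul, abs_inv, abs_norm,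
      integral_const_mul] at h1
    rwa [le_inv_mul_iff₀ (norm_pos_iff.2 hx), mul_comm] at h1

lemma abs_inner_le_supportFunction (hsymm : ∀ x ∈ K, -x ∈ K) {x : E n} (hx : x ∈ K) (y : E n) :
    |inner ℝ x y| ≤ supportFunction K y := by
  rw [abs_le']
  refine ⟨inner_le_supportFunction hx y, ?_⟩
  rw [← inner_neg_left]
  exact inner_le_supportFunction (hsymm x hx) y

/-- The closed ball as a convex body. -/
def ballBody (n : ℕ) {r : ℝ} (hr : 0 ≤ r) : ConvexBody (E n) where
  carrier := closedBall 0 r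
  convex' := convex_closedBall 0 r
  isCompact' := isCompact_closedBall 0 r
  nonempty' := ⟨0, mem_closedBall_self hr⟩

lemma exists_pos_mul_pow_le_gaussianMeasure_ball (n : ℕ) :
    ∃ c > 0, ∀ r : ℝ, 0 ≤ r → r ≤ 1 →
      c * r ^ n ≤ (gaussianMeasure n).real (closedBall (0 : E n) r) := by
  set d : ℝ := 1 / Real.sqrt (2 * Real.pi) ^ n * Real.exp (-1 / 2) with hd
  have hd0 : 0 < d := by positivity
  refine ⟨d * (volume : Measure (E n)).real (closedBall (0 : E n) 1), ?_, fun r hr hr1 => ?_⟩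
  · refine mul_pos hd0 ?_
    rw [measureReal_def, ENNReal.toReal_pos_iff]
    exact ⟨measure_closedBall_pos _ _ one_pos, measure_closedBall_lt_top⟩
  have h1 : ENNReal.ofReal d * volume (closedBall (0 : E n) r) ≤
      gaussianMeasure n (closedBall (0 : E n) r) := by
    rw [gaussianMeasure, withDensity_apply _ measurableSet_closedBall, ← setLIntegral_const]
    refine setLIntegral_mono' measurableSet_closedBall fun x hx => ?_
    refine ENNReal.ofReal_le_ofReal ?_
    rw [hd]
    have hx1 : ‖x‖ ≤ 1 := (mem_closedBall_zero_iff.1 hx).trans hr1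
    have hx2 : ‖x‖ ^ 2 ≤ 1 := pow_le_one₀ (norm_nonneg _) hx1
    gcongr
  have h2 := ENNReal.toReal_mono (measure_ne_top _ _) h1
  rw [ENNReal.toReal_mul, ENNReal.toReal_ofReal hd0.le,
    Measure.addHaar_closedBall' volume (0 : E n) hr, ENNReal.toReal_mul,
    ENNReal.toReal_ofReal (by positivity), finrank_euclideanSpace_fin] at h2
  rw [measureReal_def, measureReal_def]
  linarith

/-- For a small ball the volume term is at least of order `r ^ (n * α)` and the linear term at most
of order `r`; the former wins because `n * α < 1`. -/
lemma exists_minkowskiFunctional_pos (μ : Measure (UnitSphere n)) [IsFiniteMeasure μ]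
    {α : ℝ} (hα : 0 < α) (hαn : n * α < 1) :
    ∃ K : ConvexBody (E n), (∀ x ∈ K, -x ∈ K) ∧ 0 < minkowskiFunctional μ α K := by
  obtain ⟨c, hc, hcr⟩ := exists_pos_mul_pow_le_gaussianMeasure_ball n
  have hlim : Tendsto (fun r : ℝ => μ.real univ * r ^ (1 - n * α)) (𝓝[>] 0) (𝓝 0) := by
    have h1 : 0 < 1 - n * α := by linarith
    have := ((Real.continuousAt_rpow_const 0 (1 - n * α) (Or.inr h1.le)).tendsto.const_mul
      (μ.real univ)).mono_left (nhdsWithin_le_nhds (s := Ioi 0))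
    rwa [Real.zero_rpow h1.ne', mul_zero] at this
  have hpos : 0 < c ^ α / α := by positivity
  obtain ⟨r, hr, hr0, hr1⟩ :=
    ((hlim.eventually (gt_mem_nhds hpos)).and (Ioo_mem_nhdsGT (zero_lt_one' ℝ))).exists
  refine ⟨ballBody n hr0.le, fun x hx => ?_, ?_⟩
  · have hx' : x ∈ closedBall (0 : E n) r := hx
    change -x ∈ closedBall (0 : E n) r
    simpa using hx'
  have hγ : c * r ^ n ≤ (gaussianMeasure n).real (ballBody n hr0.le : Set (E n)) :=
    hcr r hr0.le hr1.le
  have hsup : ∫ v, supportFunction (ballBody n hr0.le) (v : E n) ∂μ ≤ μ.real univ * r := by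
    calc _ ≤ ∫ _, r ∂μ := by
          refine integral_mono (integrable_of_continuous_sphere μ
            (continuous_supportFunction_sphere _)) (integrable_const _) fun v => ?_
          refine supportFunction_le fun x hx => ?_
          have := real_inner_le_norm x (v : E n)
          rw [norm_coe_sphere, mul_one] at this
          exact this.trans (mem_closedBall_zero_iff.1 hx)
      _ = _ := by rw [integral_const, smul_eq_mul]
  have h1 : c ^ α / α * r ^ (n * α) ≤
      (gaussianMeasure n).real (ballBody n hr0.le : Set (E n)) ^ α / α := by
    have : (c * r ^ n) ^ α = c ^ α * r ^ (n * α) := by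
      rw [Real.mul_rpow hc.le (by positivity), ← Real.rpow_natCast, ← Real.rpow_mul hr0.le]
    rw [div_mul_eq_mul_div, ← this]
    gcongr
  have h2 : μ.real univ * r = μ.real univ * r ^ (1 - n * α) * r ^ (n * α) := by
    rw [mul_assoc, ← Real.rpow_add hr0, sub_add_cancel, Real.rpow_one]
  have h3 : μ.real univ * r ^ (1 - n * α) * r ^ (n * α) < c ^ α / α * r ^ (n * α) := by
    gcongr
  rw [minkowskiFunctional]
  linarith

/-- The variational problem has a solution with nonempty interior. -/
theorem exists_maximizer (hn : 1 ≤ n) (μ : Measure (UnitSphere n)) [IsFiniteMeasure μ]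
    (hμ : ∀ u : UnitSphere n, ¬ IsConcentratedIn μ (closedHemisphere u))
    {α : ℝ} (hα : 0 < α) (hαn : n * α < 1) :
    ∃ K : ConvexBody (E n), IsOriginSymmetricBody K ∧ 0 < (gaussianMeasure n).real K ∧
      ∀ L : ConvexBody (E n), (∀ x ∈ L, -x ∈ L) →
        minkowskiFunctional μ α L ≤ minkowskiFunctional μ α K := by
  obtain ⟨c, hc, hcx⟩ := exists_pos_mul_norm_le_integral_abs_inner hn μ hμ
  obtain ⟨K₁, hK₁s, hK₁⟩ := exists_minkowskiFunctional_pos μ hα hαn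
  set Z := (gaussianMeasure n).real univ ^ α / α with hZ
  -- A point `x` of such an `L` satisfies `c * ‖x‖ ≤ ∫ h_L dμ < Z`. All other competitors have value
  -- at most 0 and lose to `K₁`.
  have hbound : ∀ L : ConvexBody (E n), (∀ x ∈ L, -x ∈ L) → 0 < minkowskiFunctional μ α L →
      (L : Set (E n)) ⊆ closedBall 0 (Z / c) := by
    intro L hLs hL x hx
    rw [mem_closedBall_zero_iff, le_div_iff₀ hc, mul_comm]
    have h1 : (gaussianMeasure n).real L ^ α / α ≤ Z := by
      have := measureReal_mono (μ := gaussianMeasure n) (subset_univ (L : Set (E n)))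
      rw [hZ]
      gcongr
    have h2 : ∫ v : UnitSphere n, |inner ℝ x (v : E n)| ∂μ ≤
        ∫ v, supportFunction L (v : E n) ∂μ :=
      integral_mono (integrable_of_continuous_sphere μ (by fun_prop))
        (integrable_of_continuous_sphere μ (continuous_supportFunction_sphere L))
        fun v => abs_inner_le_supportFunction hLs hx v
    rw [minkowskiFunctional] at hL
    linarith [hcx x]
  have hmem : K₁ ∈ {K : ConvexBody (E n) |
      (K : Set (E n)) ⊆ closedBall 0 (Z / c) ∧ ∀ x ∈ K, -x ∈ K} := ⟨hbound K₁ hK₁s hK₁, hK₁s⟩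
  obtain ⟨K, hK, hmax⟩ := UpperSemicontinuousOn.exists_isMaxOn ⟨K₁, hmem⟩
    (isCompact_symmetric_convexBodies (Z / c))
    ((upperSemicontinuous_minkowskiFunctional μ hα).upperSemicontinuousOn _)
  have hKpos : 0 < minkowskiFunctional μ α K :=
    hK₁.trans_le (hmax hmem)
  have h0K : (0 : E n) ∈ K := K.zero_mem_of_symmetric hK.2
  have hγ : 0 < (gaussianMeasure n).real K := by
    refine lt_of_le_of_ne measureReal_nonneg fun h => ?_
    have h1 : 0 ≤ ∫ v, supportFunction K (v : E n) ∂μ :=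
      integral_nonneg fun v => by simpa using inner_le_supportFunction h0K (v : E n)
    rw [minkowskiFunctional, ← h, Real.zero_rpow hα.ne', zero_div] at hKpos
    linarith
  refine ⟨K, ⟨?_, hK.2⟩, hγ, fun L hLs => ?_⟩
  · rw [nonempty_iff_ne_empty]
    intro hempty
    -- A closed set with empty interior is its own frontier, and frontiers of convex sets are null.
    have hvol : volume (K : Set (E n)) = 0 := by
      have := K.convex.addHaar_frontier volume
      rwa [K.isClosed.frontier_eq, hempty, sdiff_empty] at this
    have : gaussianMeasure n K = 0 := withDensity_absolutelyContinuous _ _ hvol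
    rw [measureReal_def, this] at hγ
    simp at hγ
  · rcases le_or_gt (minkowskiFunctional μ α L) 0 with h | h
    · exact h.trans hKpos.le
    · have hL : L ∈ {K : ConvexBody (E n) |
        (K : Set (E n)) ⊆ closedBall 0 (Z / c) ∧ ∀ x ∈ K, -x ∈ K} := ⟨hbound L hLs h, hLs⟩
      exact hmax hL

end Existence

/-! ### Euler–Lagrange equation of the maximizer -/

section EulerLagrange

variable {n : ℕ} {K : ConvexBody (E n)}

/-- Concavity of the power, obtained from Bernoulli's inequality at `b / a - 1`. -/
lemma rpow_le_tangent {a b α : ℝ} (ha : 0 < a) (hb : 0 ≤ b) (hα : 0 ≤ α) (hα1 : α ≤ 1) :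
    b ^ α ≤ a ^ α + α * a ^ (α - 1) * (b - a) := by
  have h := rpow_one_add_le_one_add_mul_self (s := b / a - 1) (p := α)
    (by have : 0 ≤ b / a := by positivity
        linarith) hα hα1
  rw [add_sub_cancel, Real.div_rpow hb ha.le, div_le_iff₀ (by positivity)] at h
  refine h.trans_eq ?_
  rw [Real.rpow_sub_one ha.ne']
  field_simp

/-! ### Inequality between the measures, tested on even functions -/

/-- The Wulff shape of `h_K + t f` contains `K`, is symmetric because `f` is even, and has support
function at most `h_K + t f`. Maximality thus bounds its Gaussian measure from above, and the first
variation bounds it from below. -/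
theorem lintegral_gaussianSurfaceMeasure_le_of_even (hn : 1 ≤ n) (μ : Measure (UnitSphere n))
    [IsFiniteMeasure μ] {α : ℝ} (hα : 0 < α) (hα1 : α < 1) (hK : IsOriginSymmetricBody K)
    (hγ : 0 < (gaussianMeasure n).real K)
    (hmax : ∀ L : ConvexBody (E n), (∀ x ∈ L, -x ∈ L) →
      minkowskiFunctional μ α L ≤ minkowskiFunctional μ α K)
    (v₀ : UnitSphere n) {f : UnitSphere n → ℝ} (hf : Continuous f) (hf0 : ∀ v, 0 ≤ f v)
    (hfe : ∀ v, f (-v) = f v) :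
    ∫⁻ v, ENNReal.ofReal (f v) ∂gaussianSurfaceMeasure v₀ (gauge (K : Set (E n))) ≤
      ENNReal.ofReal ((gaussianMeasure n).real K ^ (1 - α)) * ∫⁻ v, ENNReal.ofReal (f v) ∂μ := by
  have h0 := zero_mem_interior hK
  set G := (gaussianMeasure n).real K with hG
  set F := ∫ v, f v ∂μ with hF
  have hfint := integrable_of_continuous_sphere μ hf
  have hF0 : 0 ≤ F := integral_nonneg hf0
  rw [← ofReal_integral_eq_lintegral_ofReal hfint (Eventually.of_forall hf0), ← hF,
    ← ENNReal.ofReal_mul (by positivity)]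
  have ht : ∀ k : ℕ, (0 : ℝ) < 1 / ((k : ℝ) + 1) := fun k => by positivity
  have ht0 : Tendsto (fun k : ℕ => (1 : ℝ) / ((k : ℝ) + 1)) atTop (𝓝 0) :=
    tendsto_one_div_add_atTop_nhds_zero_nat
  set t : ℕ → ℝ := fun k => 1 / ((k : ℝ) + 1) with htdef
  have hcont : ∀ k, Continuous fun v : UnitSphere n => supportFunction K (v : E n) + t k * f v :=
    fun k => (continuous_supportFunction_sphere K).add (continuous_const.mul hf)
  have hpos : ∀ k (v : UnitSphere n), 0 ≤ supportFunction K (v : E n) + t k * f v := fun k v =>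
    add_nonneg (supportFunction_pos h0 (coe_sphere_ne_zero v)).le (mul_nonneg (ht k).le (hf0 v))
  set L : ℕ → ConvexBody (E n) := fun k => wulffShape hn _ (hcont k) (hpos k) with hL
  refine (lintegral_gaussianSurfaceMeasure_le_liminf hn h0 v₀ hf hf0 ht ht0
    (L := fun k => (L k : Set (E n))) (fun k => (L k).isClosed.measurableSet)
    fun k x hx => hx).trans ?_
  have hLs : ∀ k, ∀ x ∈ L k, -x ∈ L k := by
    intro k x hx v
    have : inner ℝ x ((-v : UnitSphere n) : E n) ≤
        supportFunction K ((-v : UnitSphere n) : E n) + t k * f (-v) := hx (-v)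
    change inner ℝ (-x) (v : E n) ≤ supportFunction K (v : E n) + t k * f v
    rwa [coe_neg_sphere, inner_neg_right, supportFunction_neg hK.2, hfe, ← inner_neg_left] at this
  have hKL : ∀ k, (K : Set (E n)) ⊆ L k := fun k x hx v =>
    (inner_le_supportFunction hx v).trans (le_add_of_nonneg_right (mul_nonneg (ht k).le (hf0 v)))
  have hG' : ∀ k, (gaussianMeasure n).real (L k) ^ α ≤ G ^ α + α * (t k * F) := by
    intro k
    have h1 := hmax (L k) (hLs k)
    have h2 : ∫ v, supportFunction (L k) (v : E n) ∂μ ≤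
        ∫ v, supportFunction K (v : E n) ∂μ + t k * F := by
      rw [hF, ← integral_const_mul, ← integral_add
        (integrable_of_continuous_sphere μ (continuous_supportFunction_sphere K))
        (hfint.const_mul _)]
      exact integral_mono (integrable_of_continuous_sphere μ (continuous_supportFunction_sphere _))
        (integrable_of_continuous_sphere μ (hcont k)) fun v => supportFunction_le fun x hx => hx v
    rw [minkowskiFunctional, minkowskiFunctional, ← hG] at h1
    have h3 : (gaussianMeasure n).real (L k) ^ α / α ≤ G ^ α / α + t k * F := by linarith
    rw [div_le_iff₀ hα, add_mul, div_mul_cancel₀ _ hα.ne'] at h3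
    linarith
  have hquot : ∀ k, (t k)⁻¹ * ((gaussianMeasure n).real (L k) - G) ≤
      (G ^ α + α * (t k * F)) ^ ((1 - α) / α) * F := by
    intro k
    set Gk := (gaussianMeasure n).real (L k) with hGk
    have hGGk : G ≤ Gk := measureReal_mono (hKL k)
    have hGk0 : 0 < Gk := hγ.trans_le hGGk
    -- The tangent is taken at `Gk`, not `G`: concavity then bounds `Gk - G` from above. The
    -- resulting factor `Gk ^ (1 - α)` is controlled by `hG'`.
    have h1 := rpow_le_tangent hGk0 hγ.le hα.le hα1.le
    have h2 := hG' k
    have h3 : Gk ^ (α - 1) * (Gk - G) ≤ t k * F := by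
      have : α * (Gk ^ (α - 1) * (Gk - G)) ≤ α * (t k * F) := by linarith
      exact le_of_mul_le_mul_left this hα
    have h4 : Gk - G ≤ t k * F * Gk ^ (1 - α) := by
      have h5 : Gk ^ (1 - α) * Gk ^ (α - 1) = 1 := by
        rw [← Real.rpow_add hGk0]; simp
      calc Gk - G = Gk ^ (1 - α) * (Gk ^ (α - 1) * (Gk - G)) := by rw [← mul_assoc, h5, one_mul]
        _ ≤ Gk ^ (1 - α) * (t k * F) := by gcongr
        _ = _ := mul_comm _ _
    have h5 : Gk ^ (1 - α) ≤ (G ^ α + α * (t k * F)) ^ ((1 - α) / α) := by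
      have : Gk ^ (1 - α) = (Gk ^ α) ^ ((1 - α) / α) := by
        rw [← Real.rpow_mul hGk0.le, mul_div_cancel₀ _ hα.ne']
      rw [this]
      exact Real.rpow_le_rpow (by positivity) h2 (div_nonneg (by linarith) hα.le)
    rw [inv_mul_le_iff₀ (ht k)]
    have htF : 0 ≤ t k * F := mul_nonneg (ht k).le hF0
    calc _ ≤ t k * F * Gk ^ (1 - α) := h4
      _ ≤ t k * F * (G ^ α + α * (t k * F)) ^ ((1 - α) / α) := by gcongr
      _ = _ := by ring
  have hlim : Tendsto (fun k => ENNReal.ofReal ((G ^ α + α * (t k * F)) ^ ((1 - α) / α) * F)) atTop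
      (𝓝 (ENNReal.ofReal (G ^ (1 - α) * F))) := by
    refine ENNReal.tendsto_ofReal (Tendsto.mul_const F ?_)
    have h1 : Tendsto (fun k => G ^ α + α * (t k * F)) atTop (𝓝 (G ^ α + α * (0 * F))) :=
      ((ht0.mul_const F).const_mul α).const_add _
    rw [zero_mul, mul_zero, add_zero] at h1
    have h2 := h1.rpow_const (p := (1 - α) / α) (Or.inr (div_nonneg (by linarith) hα.le))
    rwa [← Real.rpow_mul hγ.le, mul_div_cancel₀ _ hα.ne'] at h2
  rw [← hlim.liminf_eq]
  refine liminf_le_liminf (Eventually.of_forall fun k => ?_)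
  have hdiff : gaussianMeasure n ((L k : Set (E n)) \ K) =
      ENNReal.ofReal ((gaussianMeasure n).real (L k) - G) := by
    rw [← ofReal_measureReal, measureReal_sdiff (hKL k) K.isClosed.measurableSet]
  rw [hdiff, ← ENNReal.ofReal_mul (inv_pos.2 (ht k)).le]
  exact ENNReal.ofReal_le_ofReal (hquot k)

/-! ### Dilations of the maximizer -/

/-- Passing to `(1 - s) • K` saves `s ∫ h_K dμ` in the linear term and costs at most about `s W` in
Gaussian measure, `W` being the right-hand side. Maximality, division by `s` and `s → 0` conclude;
only this one dilation is needed for the reverse inequality. -/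
theorem integral_supportFunction_le (hn : 1 ≤ n) (μ : Measure (UnitSphere n))
    [IsFiniteMeasure μ] {α : ℝ} (hα : 0 < α) (hα1 : α < 1) (hK : IsOriginSymmetricBody K)
    (hγ : 0 < (gaussianMeasure n).real K)
    (hmax : ∀ L : ConvexBody (E n), (∀ x ∈ L, -x ∈ L) →
      minkowskiFunctional μ α L ≤ minkowskiFunctional μ α K) :
    (gaussianMeasure n).real K ^ (1 - α) * ∫ v, supportFunction K (v : E n) ∂μ ≤
      (∫⁻ x, gaussianDensity n x ∂coneMeasure (gauge (K : Set (E n)))).toReal := by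
  have h0 := zero_mem_interior hK
  set G := (gaussianMeasure n).real K with hG
  set H := ∫ v, supportFunction K (v : E n) ∂μ with hH
  have hWt := lintegral_gaussianDensity_coneMeasure_lt_top h0
  set W := (∫⁻ x, gaussianDensity n x ∂coneMeasure (gauge (K : Set (E n)))).toReal with hW
  have hH0 : 0 ≤ H := integral_nonneg fun v =>
    (supportFunction_pos h0 (coe_sphere_ne_zero v)).le
  obtain ⟨R, hR⟩ := K.isBounded.exists_norm_le
  have hlimA : Tendsto (fun s : ℝ => G - s * Real.exp (s * R ^ 2) * W) (𝓝[>] 0) (𝓝 G) := by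
    have : Continuous fun s : ℝ => G - s * Real.exp (s * R ^ 2) * W := by fun_prop
    simpa using (this.tendsto 0).mono_left nhdsWithin_le_nhds
  have hlimL : Tendsto (fun s : ℝ => (G - s * Real.exp (s * R ^ 2) * W) ^ (1 - α) * H) (𝓝[>] 0)
      (𝓝 (G ^ (1 - α) * H)) :=
    (hlimA.rpow_const (Or.inl hγ.ne')).mul_const H
  have hlimR : Tendsto (fun s : ℝ => Real.exp (s * R ^ 2) * W) (𝓝[>] 0) (𝓝 W) := by
    have : Continuous fun s : ℝ => Real.exp (s * R ^ 2) * W := by fun_prop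
    simpa using (this.tendsto 0).mono_left nhdsWithin_le_nhds
  refine le_of_tendsto_of_tendsto hlimL hlimR ?_
  filter_upwards [Ioo_mem_nhdsGT (zero_lt_one' ℝ), hlimA.eventually (lt_mem_nhds hγ)] with s hs hAs
  have hs1 : 0 < 1 - s := by linarith [hs.2]
  set M : ConvexBody (E n) := (1 - s) • K with hM
  have hMc : (M : Set (E n)) = (1 - s) • (K : Set (E n)) := ConvexBody.coe_smul _ _
  have h0K : (0 : E n) ∈ K := interior_subset h0
  have hMK : (M : Set (E n)) ⊆ K := by
    rw [hMc]
    rintro _ ⟨x, hx, rfl⟩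
    have := K.convex hx h0K hs1.le hs.1.le (by ring)
    simpa using this
  have hMs : ∀ x ∈ M, -x ∈ M := by
    intro x hx
    rw [← SetLike.mem_coe, hMc] at hx ⊢
    obtain ⟨y, hy, rfl⟩ := hx
    exact ⟨-y, hK.2 y hy, by simp⟩
  set A := (gaussianMeasure n).real M with hA
  have hGA : G - A ≤ s * Real.exp (s * R ^ 2) * W := by
    have h1 := gaussianMeasure_diff_smul_le hn h0 hR hs.1 hs.2
    rw [← hMc] at h1
    have h2 := ENNReal.toReal_mono (ENNReal.mul_ne_top ENNReal.ofReal_ne_top hWt.ne) h1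
    rw [ENNReal.toReal_mul, ENNReal.toReal_ofReal (mul_nonneg hs.1.le (Real.exp_pos _).le),
      ← measureReal_def, measureReal_sdiff hMK M.isClosed.measurableSet] at h2
    exact h2
  have hA0 : 0 < A := by linarith
  have hsup : ∫ v, supportFunction M (v : E n) ∂μ ≤ (1 - s) * H := by
    rw [hH, ← integral_const_mul]
    refine integral_mono (integrable_of_continuous_sphere μ (continuous_supportFunction_sphere M))
      ((integrable_of_continuous_sphere μ (continuous_supportFunction_sphere K)).const_mul _)
      fun v => supportFunction_le fun x hx => ?_
    rw [← SetLike.mem_coe, hMc] at hx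
    obtain ⟨y, hy, rfl⟩ := hx
    simp only [inner_smul_left, RCLike.conj_to_real]
    exact mul_le_mul_of_nonneg_left (inner_le_supportFunction hy _) hs1.le
  have h1 := hmax M hMs
  rw [minkowskiFunctional, minkowskiFunctional, ← hG, ← hA, ← hH] at h1
  have h2 : α * (s * H) ≤ G ^ α - A ^ α := by
    have : A ^ α / α + s * H ≤ G ^ α / α := by linarith
    rw [div_add' _ _ _ hα.ne', div_le_div_iff_of_pos_right hα] at this
    linarith
  have h3 := rpow_le_tangent hA0 hγ.le hα.le hα1.le
  have h4 : s * H ≤ A ^ (α - 1) * (s * (Real.exp (s * R ^ 2) * W)) := by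
    have h5 : α * (s * H) ≤ α * (A ^ (α - 1) * (G - A)) := by linarith
    refine (le_of_mul_le_mul_left h5 hα).trans ?_
    gcongr
    linarith
  have h5 : A ^ (1 - α) * A ^ (α - 1) = 1 := by
    rw [← Real.rpow_add hA0]; simp
  have h6 : A ^ (1 - α) * H ≤ Real.exp (s * R ^ 2) * W := by
    refine le_of_mul_le_mul_left ?_ hs.1
    calc s * (A ^ (1 - α) * H) = A ^ (1 - α) * (s * H) := by ring
      _ ≤ A ^ (1 - α) * (A ^ (α - 1) * (s * (Real.exp (s * R ^ 2) * W))) := by gcongr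
      _ = _ := by rw [← mul_assoc, h5, one_mul]
  refine le_trans ?_ h6
  gcongr
  linarith

/-! ### Comparison of measures -/

/-- Finite measures are compared by their integrals of continuous functions. -/
lemma measure_le_of_forall_lintegral_continuous_le {X : Type*} [MetricSpace X] [MeasurableSpace X]
    [BorelSpace X] {μ ν : Measure X} [IsFiniteMeasure μ] [IsFiniteMeasure ν]
    (h : ∀ f : X → ℝ, Continuous f → (∀ x, 0 ≤ f x) →
      ∫⁻ x, ENNReal.ofReal (f x) ∂μ ≤ ∫⁻ x, ENNReal.ofReal (f x) ∂ν) : μ ≤ ν := by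
  have hclosed : ∀ F : Set X, IsClosed F → μ F ≤ ν F := by
    intro F hF
    have hlim := HasOuterApproxClosed.tendsto_lintegral_apprSeq hF ν
    refine ge_of_tendsto hlim (Eventually.of_forall fun k => ?_)
    refine (HasOuterApproxClosed.measure_le_lintegral hF μ k).trans ?_
    have := h (fun x => (hF.apprSeq k x : ℝ)) (by fun_prop) fun x => NNReal.coe_nonneg _
    simpa using this
  refine Measure.le_iff.2 fun A hA => ?_
  rw [hA.measure_eq_iSup_isClosed_of_ne_top (measure_ne_top μ A)]
  exact iSup₂_le fun F hF => iSup_le fun hFc => (hclosed F hFc).trans (measure_mono hF)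

/-- The positive function `f` integrates to zero against `ν - μ`, which must therefore vanish. -/
lemma eq_of_le_of_lintegral_le {X : Type*} [MeasurableSpace X] {μ ν : Measure X}
    [IsFiniteMeasure μ] [IsFiniteMeasure ν] (hle : μ ≤ ν) {f : X → ℝ≥0∞} (hf : Measurable f)
    (hf0 : ∀ x, 0 < f x) (hfin : ∫⁻ x, f x ∂μ ≠ ∞) (h : ∫⁻ x, f x ∂ν ≤ ∫⁻ x, f x ∂μ) : μ = ν := by
  have hsum := Measure.sub_add_cancel_of_le hle
  have h1 : ∫⁻ x, f x ∂(ν - μ) = 0 := by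
    rw [← hsum, lintegral_add_measure] at h
    have h' : ∫⁻ x, f x ∂(ν - μ) + ∫⁻ x, f x ∂μ ≤ 0 + ∫⁻ x, f x ∂μ := by
      rw [zero_add]
      simpa [hsum] using h
    exact le_antisymm ((ENNReal.add_le_add_iff_right hfin).1 h') zero_le
  have h2 : ν - μ = 0 := by
    rw [lintegral_eq_zero_iff hf] at h1
    rw [← Measure.measure_univ_eq_zero]
    refine measure_mono_null (fun x _ => ?_) (ae_iff.1 h1)
    exact (hf0 x).ne'
  rw [h2, zero_add] at hsum
  exact hsum

/-- A maximizer of the functional has the prescribed surface area measure. -/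
theorem gaussianSurfaceMeasure_eq_smul (hn : 1 ≤ n) (μ : Measure (UnitSphere n))
    [IsFiniteMeasure μ] (heven : IsEvenMeasure μ) {α : ℝ} (hα : 0 < α) (hα1 : α < 1)
    (hK : IsOriginSymmetricBody K) (hγ : 0 < (gaussianMeasure n).real K)
    (hmax : ∀ L : ConvexBody (E n), (∀ x ∈ L, -x ∈ L) →
      minkowskiFunctional μ α L ≤ minkowskiFunctional μ α K) (v₀ : UnitSphere n) :
    gaussianSurfaceMeasure v₀ (gauge (K : Set (E n))) =
      ENNReal.ofReal ((gaussianMeasure n).real K ^ (1 - α)) • μ := by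
  have h0 := zero_mem_interior hK
  set S := gaussianSurfaceMeasure v₀ (gauge (K : Set (E n))) with hS
  set c := ENNReal.ofReal ((gaussianMeasure n).real K ^ (1 - α)) with hc
  have hneg : Measurable fun v : UnitSphere n => -v := continuous_neg.measurable
  have hSneg : S.map (fun v => -v) = S := by
    ext η hη
    rw [Measure.map_apply hneg hη, hS, ← gaussianSurfaceArea_eq hn h0 v₀ hη,
      ← gaussianSurfaceArea_eq hn h0 v₀ (hneg hη), gaussianSurfaceArea_neg hK.2]
  have hμneg : μ.map (fun v => -v) = μ := by
    ext η hη
    rw [Measure.map_apply hneg hη, heven η hη]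
  have hsym : ∀ (ν : Measure (UnitSphere n)), ν.map (fun v => -v) = ν →
      ∀ f : UnitSphere n → ℝ, Continuous f → (∀ v, 0 ≤ f v) →
      ∫⁻ v, ENNReal.ofReal (f v + f (-v)) ∂ν = 2 * ∫⁻ v, ENNReal.ofReal (f v) ∂ν := by
    intro ν hν f hf hf0
    have h1 : ∫⁻ v, ENNReal.ofReal (f (-v)) ∂ν = ∫⁻ v, ENNReal.ofReal (f v) ∂ν := by
      conv_rhs => rw [← hν, lintegral_map hf.measurable.ennreal_ofReal hneg]
    simp_rw [ENNReal.ofReal_add (hf0 _) (hf0 _)]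
    rw [lintegral_add_left hf.measurable.ennreal_ofReal, h1, two_mul]
  -- Both measures are even, so replacing `f` by `f v + f (-v)` doubles both integrals and reduces
  -- to even functions.
  have hle : ∀ f : UnitSphere n → ℝ, Continuous f → (∀ v, 0 ≤ f v) →
      ∫⁻ v, ENNReal.ofReal (f v) ∂S ≤ ∫⁻ v, ENNReal.ofReal (f v) ∂(c • μ) := by
    intro f hf hf0
    have h1 := lintegral_gaussianSurfaceMeasure_le_of_even hn μ hα hα1 hK hγ hmax v₀
      (f := fun v => f v + f (-v)) (hf.add (hf.comp continuous_neg))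
      (fun v => add_nonneg (hf0 v) (hf0 _)) fun v => by rw [neg_neg, add_comm]
    rw [← hS, ← hc, hsym S hSneg f hf hf0, hsym μ hμneg f hf hf0, mul_left_comm,
      ENNReal.mul_le_mul_iff_right two_ne_zero ENNReal.ofNat_ne_top] at h1
    rwa [lintegral_smul_measure, smul_eq_mul]
  have hcμ : IsFiniteMeasure (c • μ) := Measure.smul_finite μ ENNReal.ofReal_ne_top
  have hSfin : IsFiniteMeasure S := by
    -- Finiteness of the surface measure comes from testing with the constant 1.
    refine ⟨lt_of_le_of_lt ?_ (measure_lt_top (c • μ) univ)⟩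
    simpa using hle (fun _ => 1) continuous_const fun _ => zero_le_one
  have hSle : S ≤ c • μ := measure_le_of_forall_lintegral_continuous_le hle
  have hhint := lintegral_supportFunction_gaussianSurfaceMeasure h0 v₀
  have hWt := lintegral_gaussianDensity_coneMeasure_lt_top h0
  have hhpos : ∀ v : UnitSphere n, 0 < supportFunction K (v : E n) := fun v =>
    supportFunction_pos h0 (coe_sphere_ne_zero v)
  refine eq_of_le_of_lintegral_le hSle
    (f := fun v => ENNReal.ofReal (supportFunction K (v : E n)))
    (continuous_supportFunction_sphere K).measurable.ennreal_ofReal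
    (fun v => ENNReal.ofReal_pos.2 (hhpos v)) ?_ ?_
  · rw [hhint]
    exact hWt.ne
  · rw [hhint, lintegral_smul_measure, smul_eq_mul, ← ofReal_integral_eq_lintegral_ofReal
      (integrable_of_continuous_sphere μ (continuous_supportFunction_sphere K))
      (Eventually.of_forall fun v => (hhpos v).le), hc, ← ENNReal.ofReal_mul (by positivity),
      ← ENNReal.ofReal_toReal hWt.ne]
    exact ENNReal.ofReal_le_ofReal (integral_supportFunction_le hn μ hα hα1 hK hγ hmax)

end EulerLagrange

end GaussianMinkowski

end

/-! ### The Gaussian Minkowski theorem -/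

theorem theorem3p5 (n : ℕ) (hn : 1 ≤ n)
    (μ : MeasureTheory.Measure (GaussianMinkowski.UnitSphere n))
    (hfin : MeasureTheory.IsFiniteMeasure μ)
    (heven : GaussianMinkowski.IsEvenMeasure μ)
    (hμ : ∀ u : GaussianMinkowski.UnitSphere n,
      ¬ GaussianMinkowski.IsConcentratedIn μ (GaussianMinkowski.closedHemisphere u))
    (α : ℝ) (hα : 0 < α) (hαn : α < 1 / (n : ℝ)) :
    ∃ K : ConvexBody (GaussianMinkowski.E n),
      GaussianMinkowski.IsOriginSymmetricBody K ∧
      ∀ η : Set (GaussianMinkowski.UnitSphere n), MeasurableSet η →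
        μ η = GaussianMinkowski.gaussianSurfaceArea K η /
          GaussianMinkowski.gaussianMeasure n (K : Set (GaussianMinkowski.E n)) ^ (1 - α) := by
  have hn0 : (0 : ℝ) < n := by exact_mod_cast hn
  have hnα : n * α < 1 := by rwa [lt_div_iff₀ hn0, mul_comm] at hαn
  have hα1 : α < 1 := by
    have : (1 : ℝ) ≤ n := by exact_mod_cast hn
    nlinarith
  obtain ⟨K, hK, hγ, hmax⟩ := GaussianMinkowski.exists_maximizer hn μ hμ hα hnα
  have := GaussianMinkowski.nontrivial_E hn
  -- `v₀` is only the default normal where the gradient vanishes, a null set for the cone measure.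
  obtain ⟨v₀⟩ : Nonempty (GaussianMinkowski.UnitSphere n) :=
    (NormedSpace.sphere_nonempty.2 zero_le_one).to_subtype
  refine ⟨K, hK, fun η hη => ?_⟩
  have hpow : GaussianMinkowski.gaussianMeasure n (K : Set (GaussianMinkowski.E n)) ^ (1 - α) =
      ENNReal.ofReal ((GaussianMinkowski.gaussianMeasure n).real
        (K : Set (GaussianMinkowski.E n)) ^ (1 - α)) := by
    rw [← ENNReal.ofReal_rpow_of_pos hγ, ofReal_measureReal]
  rw [GaussianMinkowski.gaussianSurfaceArea_eq hn (GaussianMinkowski.zero_mem_interior hK) v₀ hη,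
    GaussianMinkowski.gaussianSurfaceMeasure_eq_smul hn μ heven hα hα1 hK hγ hmax v₀, hpow,
    MeasureTheory.Measure.smul_apply, smul_eq_mul, mul_comm, ENNReal.mul_div_cancel_right]
  · exact (ENNReal.ofReal_pos.2 (Real.rpow_pos_of_pos hγ _)).ne'
  · exact ENNReal.ofReal_ne_top
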